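/- Let $n\ge 1$, let $\mathcal E$ be a complex Hilbert space and let $\Phi\in L^\infty_{\mathcal B(\mathcal E)}(\mathbb T^n)$ be an essentially bounded operator-valued function for which $\zeta\mapsto\Phi(\zeta)e$ is strongly measurable for every $e\in\mathcal E$. Let $H^2_{\mathcal E}(\mathbb D^n)$ be the Hilbert space of analytic functions $\sum_{k\in\mathbb N^n}a_kz^k$ on the polydisc with $a_k\in\mathcal E$ and $\sum_k\|a_k\|^2<\infty$, identified through boundary values with a closed subspace of $L^2_{\mathcal E}(\mathbb T^n)$, and let $T_\Phi=P_{H^2_{\mathcal E}(\mathbb D^n)}L_\Phi|_{H^2_{\mathcal E}(\mathbb D^n)}$ be the Toeplitz operator with symbol $\Phi$, where $L_\Phi$ is multiplication by $\Phi$ on $L^2_{\mathcal E}(\mathbb T^n)$. Suppose that $T_\Phi$ is a partial isometry, that is, $T_\Phi$ is isometric on $(\ker T_\Phi)^\perp$. Then the following are equivalent. (i) $T_\Phi$ is hyponormal, that is, $T_\Phi^*T_\Phi\ge T_\Phi T_\Phi^*$. (ii) There exist a Hilbert space $\mathcal F$ and inner functions $\Psi\in H^\infty_{\mathcal B(\mathcal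 F,\mathcal E)}(\mathbb D^n)$ and $\Theta\in H^\infty_{\mathcal B(\mathcal F)}(\mathbb D^n)$ such that $$T_\Phi=M_\Psi M_\Theta M_\Psi^*.$$ Here $H^\infty_{\mathcal B(\mathcal F,\mathcal E)}(\mathbb D^n)$ is the set of bounded analytic $\mathcal B(\mathcal F,\mathcal E)$-valued functions $\Gamma$ on $\mathbb D^n$, $M_\Gamma:H^2_{\mathcal F}(\mathbb D^n)\to H^2_{\mathcal E}(\mathbb D^n)$ is $(M_\Gamma f)(z)=\Gamma(z)f(z)$, and $\Gamma$ is inner if its boundary values are isometries a.e. on $\mathbb T^n$, meaning that for every $\eta\in\mathcal F$ the boundary function of $\Gamma(\cdot)\eta$ has norm $\|\eta\|$ a.e. on $\mathbb T^n$ (if $\mathcal F$ is separable, the exceptional null set can be chosen independently of $\eta$). -/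

import Mathlib

universe u

namespace PolydiscHardy

set_option linter.unusedSectionVars false
set_option linter.unnecessarySimpa false
open MeasureTheory Filter Topology Metric
open scoped ENNReal InnerProductSpace

noncomputable section

/-- The monomial `z^k = z₁^{k₁} ⋯ zₙ^{kₙ}`. The open unit polydisc is `ball 0 1` in `Fin n → ℂ`,
which carries the sup norm. -/
def mono {n : ℕ} (z : Fin n → ℂ) (k : Fin n → ℕ) : ℂ := ∏ i, z i ^ k i

theorem summable_norm_mono {n : ℕ} {z : Fin n → ℂ} (hz : z ∈ ball (0 : Fin n → ℂ) 1) :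
    Summable fun k : Fin n → ℕ => ‖mono z k‖ := by
  classical
  have hz' : ∀ i, ‖z i‖ < 1 := by
    intro i
    exact lt_of_le_of_lt (norm_le_pi_norm z i) (by simpa using hz)
  refine summable_of_sum_le (c := ∏ i, (1 - ‖z i‖)⁻¹) (fun _ => norm_nonneg _) fun s => ?_
  let N : ℕ := s.sup (fun k => ∑ i, k i) + 1
  have hsub : s ⊆ Fintype.piFinset fun _ : Fin n => Finset.range N := by
    intro k hk
    rw [Fintype.mem_piFinset]
    intro i
    have h1 : k i ≤ ∑ j, k j := Finset.single_le_sum (fun _ _ => Nat.zero_le _) (Finset.mem_univ i)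
    have h2 : ∑ j, k j ≤ s.sup (fun k => ∑ i, k i) :=
      Finset.le_sup (f := fun k : Fin n → ℕ => ∑ i, k i) hk
    simp only [Finset.mem_range, N]
    omega
  calc ∑ k ∈ s, ‖mono z k‖ ≤ ∑ k ∈ Fintype.piFinset fun _ : Fin n => Finset.range N, ‖mono z k‖ :=
        Finset.sum_le_sum_of_subset_of_nonneg hsub fun _ _ _ => norm_nonneg _
    _ = ∏ i, ∑ j ∈ Finset.range N, ‖z i‖ ^ j := by
        rw [Finset.prod_univ_sum]
        simp [mono, norm_prod, norm_pow]
    _ ≤ _ := by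
        refine Finset.prod_le_prod (fun i _ => Finset.sum_nonneg fun _ _ => by positivity) ?_
        intro i _
        rw [← tsum_geometric_of_lt_one (norm_nonneg _) (hz' i)]
        exact (summable_geometric_of_lt_one (norm_nonneg _) (hz' i)).sum_le_tsum _
          (fun _ _ => by positivity)

theorem cons_mem_ball {n : ℕ} {w : ℂ} {z : Fin n → ℂ} (hw : w ∈ ball (0 : ℂ) 1)
    (hz : z ∈ ball (0 : Fin n → ℂ) 1) :
    (Fin.cons w z : Fin (n + 1) → ℂ) ∈ ball (0 : Fin (n + 1) → ℂ) 1 := by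
  rw [mem_ball_zero_iff, pi_norm_lt_iff one_pos] at *
  intro i
  refine Fin.cases ?_ ?_ i
  · simpa using hw
  · intro j; simpa using hz j

/-- A bounded analytic function on the polydisc is the sum of its Taylor series there. -/
theorem exists_taylor {G : Type*} [NormedAddCommGroup G] [NormedSpace ℂ G] [CompleteSpace G]
    {n : ℕ} {g : (Fin n → ℂ) → G} {C : ℝ}
    (hg : AnalyticOnNhd ℂ g (ball 0 1)) (hC : ∀ z ∈ ball (0 : Fin n → ℂ) 1, ‖g z‖ ≤ C) :
    ∃ A : (Fin n → ℕ) → G, (∀ k, ‖A k‖ ≤ C) ∧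
      ∀ z ∈ ball (0 : Fin n → ℂ) 1, HasSum (fun k => mono z k • A k) (g z) := by
  induction n with
  | zero =>
    refine ⟨fun _ => g 0, fun _ => hC 0 (by simp), fun z _ => ?_⟩
    have : z = 0 := Subsingleton.elim _ _
    subst this
    simpa [mono] using hasSum_unique fun k : Fin 0 → ℕ => mono (0 : Fin 0 → ℂ) k • g 0
  | succ n ih =>
    let e : Fin (n + 1) → ℂ := Pi.single 0 1
    let D : ((Fin (n + 1) → ℂ) → G) → (Fin (n + 1) → ℂ) → G := fun u z => fderiv ℂ u z e
    have hD : ∀ m, AnalyticOnNhd ℂ (D^[m] g) (ball 0 1) := by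
      intro m
      induction m with
      | zero => exact hg
      | succ m ihm =>
        rw [Function.iterate_succ_apply']
        exact (ContinuousLinearMap.apply ℂ G e).comp_analyticOnNhd ihm.fderiv
    have hderiv : ∀ z ∈ ball (0 : Fin n → ℂ) 1, ∀ m, ∀ w ∈ ball (0 : ℂ) 1,
        iteratedDeriv m (fun w : ℂ => g (Fin.cons w z)) w = (D^[m] g) (Fin.cons w z) := by
      intro z hz m
      induction m with
      | zero => intro w _; simp
      | succ m ihm =>
        intro w hw
        rw [iteratedDeriv_succ, Function.iterate_succ_apply']
        have hev : iteratedDeriv m (fun w : ℂ => g (Fin.cons w z)) =ᶠ[𝓝 w]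
            fun w => (D^[m] g) (Fin.cons w z) := by
          filter_upwards [isOpen_ball.mem_nhds hw] with v hv using ihm v hv
        rw [hev.deriv_eq]
        have hline : HasDerivAt (fun w : ℂ => (Fin.cons w z : Fin (n + 1) → ℂ)) e w := by
          rw [hasDerivAt_pi]
          intro i
          refine Fin.cases ?_ ?_ i
          · simpa [e] using! hasDerivAt_id w
          · intro j; simpa [e] using hasDerivAt_const w (z j)
        have h1 := ((hD m _ (cons_mem_ball hw hz)).differentiableAt).hasFDerivAt
        exact (h1.comp_hasDerivAt w hline).deriv
    have hdiff : ∀ z ∈ ball (0 : Fin n → ℂ) 1,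
        DifferentiableOn ℂ (fun w : ℂ => g (Fin.cons w z)) (ball 0 1) := by
      intro z hz w hw
      have hline : DifferentiableAt ℂ (fun w : ℂ => (Fin.cons w z : Fin (n + 1) → ℂ)) w := by
        rw [differentiableAt_pi]
        intro i
        refine Fin.cases ?_ ?_ i
        · simp
        · intro j; simp
      exact ((hg _ (cons_mem_ball hw hz)).differentiableAt.comp w hline).differentiableWithinAt
    let q : ℕ → (Fin n → ℂ) → G := fun m z => ((m.factorial : ℂ)⁻¹) • (D^[m] g) (Fin.cons 0 z)
    have hq : ∀ m, AnalyticOnNhd ℂ (q m) (ball 0 1) := by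
      intro m z hz
      have h1 := hD m _ (cons_mem_ball (mem_ball_self one_pos) hz)
      have h2 : AnalyticAt ℂ (fun z : Fin n → ℂ => (Fin.cons 0 z : Fin (n + 1) → ℂ)) z := by
        rw [analyticAt_pi_iff]
        intro i
        refine Fin.cases ?_ ?_ i
        · simpa using analyticAt_const
        · intro j
          simpa using! (ContinuousLinearMap.proj (R := ℂ) (φ := fun _ : Fin n => ℂ) j).analyticAt z
      exact (h1.comp h2).const_smul
    have hqC : ∀ m, ∀ z ∈ ball (0 : Fin n → ℂ) 1, ‖q m z‖ ≤ C := by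
      intro m z hz
      have hC0 : 0 ≤ C := (norm_nonneg _).trans (hC 0 (by simp))
      have key : ∀ R ∈ Set.Ioo (0 : ℝ) 1, ‖q m z‖ * R ^ m ≤ C := by
        intro R hR
        have hcl : closedBall (0 : ℂ) R ⊆ ball 0 1 := closedBall_subset_ball hR.2
        have := Complex.norm_iteratedDeriv_le_of_forall_mem_sphere_norm_le (C := C) m hR.1
          (((hdiff z hz).mono hcl).diffContOnCl_ball subset_rfl)
          (fun w hw => hC _ (cons_mem_ball (hcl (sphere_subset_closedBall hw)) hz))
        rw [hderiv z hz m 0 (by simp)] at this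
        have hm : (0 : ℝ) < m.factorial := by exact_mod_cast m.factorial_pos
        rw [le_div_iff₀ (pow_pos hR.1 m)] at this
        simp only [q, norm_smul, norm_inv, Complex.norm_natCast]
        rw [mul_assoc, inv_mul_le_iff₀ hm]
        exact this
      have hlim : Tendsto (fun R : ℝ => ‖q m z‖ * R ^ m) (𝓝[<] 1) (𝓝 (‖q m z‖ * 1 ^ m)) :=
        ((continuous_const.mul (continuous_pow m)).tendsto 1).mono_left nhdsWithin_le_nhds
      have := le_of_tendsto hlim (by
        filter_upwards [Ioo_mem_nhdsLT (zero_lt_one' ℝ)] with R hR using key R hR)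
      simpa using this
    choose B hB1 hB2 using fun m => ih (hq m) (hqC m)
    refine ⟨fun k => B (k 0) (Fin.tail k), fun k => hB1 _ _, fun z hz => ?_⟩
    have hz0 : z 0 ∈ ball (0 : ℂ) 1 := by
      rw [mem_ball_zero_iff] at *
      exact lt_of_le_of_lt (norm_le_pi_norm z 0) hz
    have hzt : Fin.tail z ∈ ball (0 : Fin n → ℂ) 1 := by
      rw [mem_ball_zero_iff, pi_norm_lt_iff one_pos] at *
      exact fun i => hz i.succ
    have hsum : Summable fun k : Fin (n + 1) → ℕ => mono z k • B (k 0) (Fin.tail k) := by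
      refine Summable.of_norm_bounded (g := fun k => ‖mono z k‖ * C)
        ((summable_norm_mono hz).mul_right C) fun k => ?_
      rw [norm_smul]
      exact mul_le_mul_of_nonneg_left (hB1 _ _) (norm_nonneg _)
    have h1 : HasSum ((fun k : Fin (n + 1) → ℕ => mono z k • B (k 0) (Fin.tail k)) ∘
        Fin.consEquiv fun _ => ℕ) (∑' k : Fin (n + 1) → ℕ, mono z k • B (k 0) (Fin.tail k)) :=
      (Fin.consEquiv fun _ => ℕ).hasSum_iff.mpr hsum.hasSum
    have h2 := h1.prod_fiberwise (g := fun m => z 0 ^ m • q m (Fin.tail z)) (fun m => by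
      have := (hB2 m _ hzt).const_smul (z 0 ^ m)
      convert this using 1
      funext c
      have : mono z (Fin.cons m c) = z 0 ^ m * mono (Fin.tail z) c := by
        simp [mono, Fin.prod_univ_succ, Fin.tail]
      simp [Fin.consEquiv, this, mul_smul])
    have h3 := Complex.hasSum_taylorSeries_on_ball (hdiff _ hzt) hz0
    have h4 : g z = ∑' k : Fin (n + 1) → ℕ, mono z k • B (k 0) (Fin.tail k) := by
      rw [Fin.cons_self_tail] at h3
      refine h3.unique ?_
      convert h2 using 1
      funext m
      rw [hderiv _ hzt m 0 (by simp)]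
      simp only [q, sub_zero]
      rw [smul_comm]
    rw [h4]
    exact hsum.hasSum


/-- Normalized Lebesgue measure on the torus `𝕋ⁿ`. A point of the torus is given by its angles
`t ∈ (ℝ/ℤ)ⁿ`, standing for `ζ = (e^{2π i t₁}, …, e^{2π i tₙ})`. -/
def torusMeasure (n : ℕ) : Measure (UnitAddTorus (Fin n)) :=
  Measure.pi fun _ => AddCircle.haarAddCircle

instance (n : ℕ) : IsProbabilityMeasure (torusMeasure n) := by
  unfold torusMeasure; infer_instance

variable {n : ℕ} {E F : Type*} [NormedAddCommGroup E] [InnerProductSpace ℂ E]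
  [NormedAddCommGroup F] [InnerProductSpace ℂ F]

/-- `L²_E(𝕋ⁿ)`. -/
abbrev L2 (n : ℕ) (E : Type*) [NormedAddCommGroup E] : Type _ := Lp E 2 (torusMeasure n)

/-- `H²_E(𝔻ⁿ)`: the analytic functions `∑ a_k z^k` with `a_k ∈ E`, `∑ ‖a_k‖² < ∞`, given by their
Taylor coefficients; the value at a point is `eval`. -/
abbrev H2 (n : ℕ) (E : Type*) [NormedAddCommGroup E] : Type _ :=
  lp (fun _ : Fin n → ℕ => E) 2

/-- The character `ζ ↦ ζ^k` of the torus. -/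
abbrev character (k : Fin n → ℕ) : C(UnitAddTorus (Fin n), ℂ) :=
  UnitAddTorus.mFourier fun i => (k i : ℤ)

/-- The continuous function `ζ ↦ ζ^k e` on the torus. -/
def monomialC (k : Fin n → ℕ) (e : E) : C(UnitAddTorus (Fin n), E) :=
  ⟨fun t => character k t • e, by fun_prop⟩

theorem inner_character (k l : Fin n → ℕ) :
    ∫ t, (starRingEnd ℂ) (character k t) * character l t ∂torusMeasure n = if k = l then 1 else 0 := by
  have h := orthonormal_iff_ite.mp (UnitAddTorus.orthonormal_mFourier (d := Fin n))
    (fun i => (k i : ℤ)) (fun i => (l i : ℤ))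
  have h2 : ((fun i => (k i : ℤ)) = fun i => (l i : ℤ)) ↔ k = l := by
    simp [funext_iff]
  simp only [h2] at h
  rw [← h, ContinuousMap.inner_toLp]
  simp only [mul_comm]
  rfl

theorem inner_monomialC (k l : Fin n → ℕ) (e e' : E) :
    ⟪ContinuousMap.toLp 2 (torusMeasure n) ℂ (monomialC k e),
      ContinuousMap.toLp 2 (torusMeasure n) ℂ (monomialC l e')⟫_ℂ =
      if k = l then ⟪e, e'⟫_ℂ else 0 := by
  rw [MeasureTheory.L2.inner_def]
  have : ∀ᵐ t ∂torusMeasure n, ⟪ContinuousMap.toLp 2 (torusMeasure n) ℂ (monomialC k e) t,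
      ContinuousMap.toLp 2 (torusMeasure n) ℂ (monomialC l e') t⟫_ℂ =
      (starRingEnd ℂ) (character k t) * character l t * ⟪e, e'⟫_ℂ := by
    filter_upwards [ContinuousMap.coeFn_toLp (𝕜 := ℂ) (p := 2) (torusMeasure n) (monomialC k e),
      ContinuousMap.coeFn_toLp (𝕜 := ℂ) (p := 2) (torusMeasure n) (monomialC l e')] with t h1 h2
    rw [h1, h2]
    simp only [monomialC, ContinuousMap.coe_mk, inner_smul_left, inner_smul_right]
    ring
  rw [integral_congr_ae this, integral_mul_const, inner_character]
  split_ifs <;> simp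

/-- The isometry `e ↦ ζ^k e` of `E` into `L²_E(𝕋ⁿ)`. -/
def monomialL2 (n : ℕ) (E : Type*) [NormedAddCommGroup E] [InnerProductSpace ℂ E] (k : Fin n → ℕ) :
    E →ₗᵢ[ℂ] L2 n E where
  toFun e := ContinuousMap.toLp 2 (torusMeasure n) ℂ (monomialC k e)
  map_add' e e' := by
    rw [← map_add]; congr 1; ext t; simp [monomialC]
  map_smul' c e := by
    rw [RingHom.id_apply, ← map_smul]; congr 1; ext t; simp [monomialC, smul_comm c]
  norm_map' e := by
    have h := inner_monomialC k k e e
    rw [if_pos rfl, inner_self_eq_norm_sq_to_K, inner_self_eq_norm_sq_to_K] at h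
    have h2 : ‖ContinuousMap.toLp 2 (torusMeasure n) ℂ (monomialC k e)‖ ^ 2 = ‖e‖ ^ 2 := by
      exact_mod_cast h
    exact (sq_eq_sq₀ (norm_nonneg _) (norm_nonneg _)).mp h2

theorem orthogonalFamily_monomialL2 :
    OrthogonalFamily ℂ (fun _ : Fin n → ℕ => E) (monomialL2 n E) := by
  intro k l hkl v w
  exact (inner_monomialC k l v w).trans (if_neg hkl)

/-- The boundary value map `H²_E(𝔻ⁿ) → L²_E(𝕋ⁿ)`, `∑ a_k z^k ↦ ∑ a_k ζ^k`: the canonical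
isometric identification of `H²_E(𝔻ⁿ)` with the subspace `H²_E(𝕋ⁿ)` of `L²_E(𝕋ⁿ)`. It is given by
radial limits, see `ae_eq_of_tendsto_radial`. -/
def boundary (n : ℕ) (E : Type*) [NormedAddCommGroup E] [InnerProductSpace ℂ E] [CompleteSpace E] :
    H2 n E →ₗᵢ[ℂ] L2 n E :=
  (orthogonalFamily_monomialL2 (n := n) (E := E)).linearIsometry

/-- The value `f(z) = ∑ a_k z^k` of `f ∈ H²_E(𝔻ⁿ)` at a point `z` of the polydisc. -/
def eval (f : H2 n E) (z : Fin n → ℂ) : E := ∑' k, mono z k • f k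

theorem summable_norm_eval (f : H2 n E) {z : Fin n → ℂ} (hz : z ∈ ball (0 : Fin n → ℂ) 1) :
    Summable fun k => ‖mono z k • f k‖ := by
  refine Summable.of_nonneg_of_le (fun _ => norm_nonneg _) (fun k => ?_)
    ((summable_norm_mono hz).mul_right ‖f‖)
  rw [norm_smul]
  exact mul_le_mul_of_nonneg_left (lp.norm_apply_le_norm two_ne_zero f k) (norm_nonneg _)

theorem hasSum_eval [CompleteSpace E] (f : H2 n E) {z : Fin n → ℂ}
    (hz : z ∈ ball (0 : Fin n → ℂ) 1) : HasSum (fun k => mono z k • f k) (eval f z) :=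
  (summable_norm_eval f hz).of_norm.hasSum

theorem eval_add [CompleteSpace E] (f g : H2 n E) {z : Fin n → ℂ}
    (hz : z ∈ ball (0 : Fin n → ℂ) 1) : eval (f + g) z = eval f z + eval g z := by
  refine (hasSum_eval (f + g) hz).unique ?_
  convert (hasSum_eval f hz).add (hasSum_eval g hz) using 2
  simp

theorem eval_smul [CompleteSpace E] (c : ℂ) (f : H2 n E) {z : Fin n → ℂ}
    (hz : z ∈ ball (0 : Fin n → ℂ) 1) : eval (c • f) z = c • eval f z := by
  refine (hasSum_eval (c • f) hz).unique ?_
  convert (hasSum_eval f hz).const_smul c using 2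
  simp [smul_comm c]

/-- The point `r ζ` of the polydisc, where `ζ = (e^{2π i t₁}, …, e^{2π i tₙ})`. -/
def radialPoint (r : ℝ) (t : UnitAddTorus (Fin n)) : Fin n → ℂ := fun i => r * fourier 1 (t i)

theorem radialPoint_mem {r : ℝ} (hr : r ∈ Set.Ico (0 : ℝ) 1) (t : UnitAddTorus (Fin n)) :
    radialPoint r t ∈ ball (0 : Fin n → ℂ) 1 := by
  rw [mem_ball_zero_iff, pi_norm_lt_iff one_pos]
  intro i
  simpa [radialPoint, fourier_apply, Circle.norm_coe, abs_of_nonneg hr.1] using hr.2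

theorem mono_radialPoint (r : ℝ) (t : UnitAddTorus (Fin n)) (k : Fin n → ℕ) :
    mono (radialPoint r t) k = (r : ℂ) ^ (∑ i, k i) * character k t := by
  simp only [mono, radialPoint, mul_pow, Finset.prod_mul_distrib, Finset.prod_pow_eq_pow_sum]
  congr 1
  simp only [character, UnitAddTorus.mFourier, ContinuousMap.coe_mk]
  refine Finset.prod_congr rfl fun i _ => ?_
  simp [fourier_apply, AddCircle.toCircle_nsmul]

theorem boundary_ae_eq [CompleteSpace E] (b : H2 n E) (hb : Summable fun k => ‖b k‖) :
    boundary n E b =ᵐ[torusMeasure n] fun t => ∑' k, character k t • b k := by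
  have h1 : Summable fun k => monomialC k (b k) := by
    refine Summable.of_norm_bounded hb fun k => ?_
    refine (ContinuousMap.norm_le _ (norm_nonneg _)).mpr fun t => ?_
    simp only [monomialC, ContinuousMap.coe_mk, norm_smul]
    refine mul_le_of_le_one_left (norm_nonneg _) ?_
    exact (ContinuousMap.norm_coe_le_norm _ t).trans UnitAddTorus.mFourier_norm.le
  have h2 := h1.hasSum.mapL (ContinuousMap.toLp 2 (torusMeasure n) ℂ)
  have h3 : boundary n E b = ContinuousMap.toLp 2 (torusMeasure n) ℂ (∑' k, monomialC k (b k)) :=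
    ((orthogonalFamily_monomialL2 (n := n) (E := E)).hasSum_linearIsometry b).unique h2
  rw [h3]
  refine (ContinuousMap.coeFn_toLp (𝕜 := ℂ) (p := 2) (torusMeasure n) _).trans (ae_of_all _ ?_)
  intro t
  exact (ContinuousMap.tsum_apply h1 t).symm

theorem memℓp_two_iff {f : (Fin n → ℕ) → E} :
    Memℓp f 2 ↔ Summable fun k => ‖f k‖ ^ 2 := by
  rw [memℓp_gen_iff (by norm_num)]
  simp only [ENNReal.toReal_ofNat, Real.rpow_ofNat]

theorem norm_le_of_sum_sq_le {f : H2 n E} {C : ℝ} (hC : 0 ≤ C)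
    (h : ∀ s : Finset (Fin n → ℕ), ∑ k ∈ s, ‖f k‖ ^ 2 ≤ C ^ 2) : ‖f‖ ≤ C := by
  refine lp.norm_le_of_forall_sum_le (by norm_num) hC fun s => ?_
  simpa only [ENNReal.toReal_ofNat, Real.rpow_ofNat] using h s

theorem sum_sq_le (f : H2 n E) (s : Finset (Fin n → ℕ)) : ∑ k ∈ s, ‖f k‖ ^ 2 ≤ ‖f‖ ^ 2 := by
  have := lp.sum_rpow_le_norm_rpow (p := 2) (by norm_num) f s
  simpa only [ENNReal.toReal_ofNat, Real.rpow_ofNat] using this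

theorem memℓp_dilate {r : ℝ} (hr : r ∈ Set.Ico (0 : ℝ) 1) (f : H2 n E) :
    Memℓp (fun k : Fin n → ℕ => (r : ℂ) ^ (∑ i, k i) • f k) 2 := by
  rw [memℓp_two_iff]
  refine Summable.of_nonneg_of_le (fun _ => sq_nonneg _) (fun k => ?_)
    (memℓp_two_iff.mp (lp.memℓp f))
  gcongr
  rw [norm_smul, norm_pow, Complex.norm_real, Real.norm_of_nonneg hr.1]
  exact mul_le_of_le_one_left (norm_nonneg _) (pow_le_one₀ hr.1 hr.2.le)

/-- The dilation `f_r(z) = f(r z)`. -/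
def dilate {r : ℝ} (hr : r ∈ Set.Ico (0 : ℝ) 1) (f : H2 n E) : H2 n E :=
  ⟨fun k => (r : ℂ) ^ (∑ i, k i) • f k, memℓp_dilate hr f⟩

theorem dilate_apply {r : ℝ} (hr : r ∈ Set.Ico (0 : ℝ) 1) (f : H2 n E) (k : Fin n → ℕ) :
    dilate hr f k = (r : ℂ) ^ (∑ i, k i) • f k := rfl

theorem norm_dilate_apply {r : ℝ} (hr : r ∈ Set.Ico (0 : ℝ) 1) (f : H2 n E) (k : Fin n → ℕ) :
    ‖dilate hr f k‖ = r ^ (∑ i, k i) * ‖f k‖ := by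
  rw [dilate_apply, norm_smul, norm_pow, Complex.norm_real, Real.norm_of_nonneg hr.1]

theorem norm_dilate_le {r : ℝ} (hr : r ∈ Set.Ico (0 : ℝ) 1) (f : H2 n E) :
    ‖dilate hr f‖ ≤ ‖f‖ := by
  refine norm_le_of_sum_sq_le (norm_nonneg _) fun s => le_trans ?_ (sum_sq_le f s)
  refine Finset.sum_le_sum fun k _ => ?_
  gcongr
  rw [norm_dilate_apply]
  exact mul_le_of_le_one_left (norm_nonneg _) (pow_le_one₀ hr.1 hr.2.le)

theorem norm_mono_radialPoint {r : ℝ} (hr : r ∈ Set.Ico (0 : ℝ) 1) (t : UnitAddTorus (Fin n))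
    (k : Fin n → ℕ) : ‖mono (radialPoint r t) k‖ = r ^ (∑ i, k i) := by
  simp [mono, radialPoint, norm_prod, Circle.norm_coe, fourier_apply, abs_of_nonneg hr.1,
    Finset.prod_pow_eq_pow_sum]

theorem boundary_dilate [CompleteSpace E] {r : ℝ} (hr : r ∈ Set.Ico (0 : ℝ) 1) (f : H2 n E) :
    boundary n E (dilate hr f) =ᵐ[torusMeasure n] fun t => eval f (radialPoint r t) := by
  have hs : Summable fun k => ‖dilate hr f k‖ := by
    have := summable_norm_eval f (radialPoint_mem hr (0 : UnitAddTorus (Fin n)))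
    simpa only [norm_smul, norm_mono_radialPoint hr, ← norm_dilate_apply hr] using this
  refine (boundary_ae_eq _ hs).trans (ae_of_all _ fun t => ?_)
  simp only [eval, mono_radialPoint, dilate_apply, smul_smul, mul_comm]

theorem eq_of_eval_eq [CompleteSpace E] {f g : H2 n E}
    (h : ∀ z ∈ ball (0 : Fin n → ℂ) 1, eval f z = eval g z) : f = g := by
  have hr : (1 / 2 : ℝ) ∈ Set.Ico (0 : ℝ) 1 := by norm_num
  have h1 : boundary n E (dilate hr f) = boundary n E (dilate hr g) := by
    refine Lp.ext ?_
    filter_upwards [boundary_dilate hr f, boundary_dilate hr g] with t h1 h2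
    rw [h1, h2, h _ (radialPoint_mem hr t)]
  have h2 := (boundary n E).injective h1
  ext k
  have h3 : dilate hr f k = dilate hr g k := by rw [h2]
  rw [dilate_apply, dilate_apply] at h3
  exact smul_right_injective E (pow_ne_zero _ (by norm_num)) h3

/-- `H^∞_{B(F,E)}(𝔻ⁿ)`: bounded analytic `B(F,E)`-valued functions on the polydisc
(values outside the polydisc play no role). -/
structure HInf (n : ℕ) (F E : Type*) [NormedAddCommGroup F] [InnerProductSpace ℂ F]
    [NormedAddCommGroup E] [InnerProductSpace ℂ E] where
  toFun : (Fin n → ℂ) → F →L[ℂ] E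
  analyticOnNhd' : AnalyticOnNhd ℂ toFun (ball 0 1)
  bounded' : ∃ C : ℝ, ∀ z ∈ ball (0 : Fin n → ℂ) 1, ‖toFun z‖ ≤ C

/-- The pointwise product `Θ f` has a power series on the polydisc. -/
theorem HInf.exists_coeff [CompleteSpace E] [CompleteSpace F] (Θ : HInf n F E) (f : H2 n F) :
    ∃ c : (Fin n → ℕ) → E, ∀ z ∈ ball (0 : Fin n → ℂ) 1,
      Summable (fun m => ‖mono z m • c m‖) ∧
      HasSum (fun m => mono z m • c m) (Θ.toFun z (eval f z)) := by
  obtain ⟨C, hC⟩ := Θ.bounded'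
  obtain ⟨A, hA, hsum⟩ := exists_taylor Θ.analyticOnNhd' hC
  let s : (Fin n → ℕ) × (Fin n → ℕ) → (Fin n → ℕ) := fun p => p.1 + p.2
  refine ⟨fun m => ∑' p : {p // s p = m}, A p.1.1 (f p.1.2), fun z hz => ?_⟩
  let u : (Fin n → ℕ) × (Fin n → ℕ) → E := fun p => (mono z p.1 • A p.1) (mono z p.2 • f p.2)
  have hmono : ∀ p, u p = mono z (s p) • A p.1 (f p.2) := by
    intro p
    simp only [u, s, mono, Pi.add_apply, pow_add, Finset.prod_mul_distrib,
      smul_apply, map_smul, smul_smul]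
    rw [mul_comm]
  have hA' : Summable fun k => ‖mono z k • A k‖ := by
    refine Summable.of_nonneg_of_le (fun _ => norm_nonneg _) (fun k => ?_)
      ((summable_norm_mono hz).mul_right C)
    rw [norm_smul]
    exact mul_le_mul_of_nonneg_left (hA k) (norm_nonneg _)
  have hu : Summable fun p => ‖u p‖ := by
    refine Summable.of_nonneg_of_le (fun _ => norm_nonneg _) (fun p => ?_)
      (hA'.mul_of_nonneg (summable_norm_eval f hz) (fun _ => norm_nonneg _) (fun _ => norm_nonneg _))
    exact ContinuousLinearMap.le_opNorm _ _
  have huval : HasSum u (Θ.toFun z (eval f z)) := by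
    have h1 := hu.of_norm.hasSum
    have h2 := h1.prod_fiberwise (g := fun k => (mono z k • A k) (eval f z))
      fun k => (hasSum_eval f hz).mapL (mono z k • A k)
    have h3 := (hsum z hz).mapL (ContinuousLinearMap.apply ℂ E (eval f z))
    have h4 : _ = Θ.toFun z (eval f z) := h2.unique h3
    rw [← h4]
    exact h1
  let e := Equiv.sigmaFiberEquiv s
  have hfib : ∀ m, mono z m • (∑' p : {p // s p = m}, A p.1.1 (f p.1.2)) =
      ∑' p : {p // s p = m}, (u ∘ e) ⟨m, p⟩ := by
    intro m
    rw [← tsum_const_smul'']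
    refine tsum_congr fun p => ?_
    change _ = u p.1
    rw [hmono, p.2]
  have hue : Summable fun q => ‖(u ∘ e) q‖ := (e.summable_iff (f := fun p => ‖u p‖)).mpr hu
  constructor
  · refine Summable.of_nonneg_of_le (fun _ => norm_nonneg _) (fun m => ?_) hue.sigma
    rw [hfib]
    exact norm_tsum_le_tsum_norm (hue.sigma_factor m)
  · have h1 : HasSum (u ∘ e) (Θ.toFun z (eval f z)) := e.hasSum_iff.mpr huval
    simp only [hfib]
    exact h1.sigma fun m => (hue.of_norm.sigma_factor m).hasSum

/-- The pointwise product `Θ f` is in `H²`, with norm at most `C ‖f‖`. -/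
theorem HInf.exists_mul [CompleteSpace E] [CompleteSpace F] (Θ : HInf n F E) :
    ∃ C : ℝ, ∀ f : H2 n F, ∃ g : H2 n E,
      (∀ z ∈ ball (0 : Fin n → ℂ) 1, eval g z = Θ.toFun z (eval f z)) ∧ ‖g‖ ≤ C * ‖f‖ := by
  obtain ⟨C, hC⟩ := Θ.bounded'
  have hC0 : 0 ≤ C := (norm_nonneg _).trans (hC 0 (by simp))
  refine ⟨C, fun f => ?_⟩
  obtain ⟨c, hc⟩ := Θ.exists_coeff f
  have key : ∀ r ∈ Set.Ico (0 : ℝ) 1, ∀ s : Finset (Fin n → ℕ),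
      ∑ m ∈ s, (r ^ (∑ i, m i) * ‖c m‖) ^ 2 ≤ (C * ‖f‖) ^ 2 := by
    intro r hr s
    have hs : Summable fun m => ‖(r : ℂ) ^ (∑ i, m i) • c m‖ := by
      have := (hc _ (radialPoint_mem hr (0 : UnitAddTorus (Fin n)))).1
      simpa only [norm_smul, norm_mono_radialPoint hr, norm_pow, Complex.norm_real,
        Real.norm_of_nonneg hr.1] using this
    have hmem : Memℓp (fun m : Fin n → ℕ => (r : ℂ) ^ (∑ i, m i) • c m) 2 := by
      refine Memℓp.of_exponent_ge (q := 1) (memℓp_gen ?_) one_le_two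
      simpa using hs
    let b : H2 n E := ⟨_, hmem⟩
    have hb : boundary n E b =ᵐ[torusMeasure n]
        fun t => Θ.toFun (radialPoint r t) (eval f (radialPoint r t)) := by
      refine (boundary_ae_eq b hs).trans (ae_of_all _ fun t => ?_)
      change _ = Θ.toFun (radialPoint r t) (eval f (radialPoint r t))
      rw [← (hc _ (radialPoint_mem hr t)).2.tsum_eq]
      refine tsum_congr fun m => ?_
      change character m t • ((r : ℂ) ^ (∑ i, m i) • c m) = _
      rw [mono_radialPoint, smul_smul, mul_comm]
    have hnorm : ‖b‖ ≤ C * ‖f‖ := by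
      rw [← (boundary n E).norm_map b]
      refine le_trans ?_ (mul_le_mul_of_nonneg_left (norm_dilate_le hr f) hC0)
      rw [← (boundary n F).norm_map (dilate hr f)]
      refine Lp.norm_le_mul_norm_of_ae_le_mul ?_
      filter_upwards [hb, boundary_dilate hr f] with t h1 h2
      rw [h1, h2]
      exact (Θ.toFun _).le_of_opNorm_le (hC _ (radialPoint_mem hr t)) _
    have hbk : ∀ m, ‖b m‖ = r ^ (∑ i, m i) * ‖c m‖ := by
      intro m
      change ‖(r : ℂ) ^ (∑ i, m i) • c m‖ = _
      rw [norm_smul, norm_pow, Complex.norm_real, Real.norm_of_nonneg hr.1]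
    calc _ = ∑ m ∈ s, ‖b m‖ ^ 2 := by simp only [hbk]
      _ ≤ ‖b‖ ^ 2 := sum_sq_le b s
      _ ≤ _ := by gcongr
  have key1 : ∀ s : Finset (Fin n → ℕ), ∑ m ∈ s, ‖c m‖ ^ 2 ≤ (C * ‖f‖) ^ 2 := by
    intro s
    have hlim : Tendsto (fun r : ℝ => ∑ m ∈ s, (r ^ (∑ i, m i) * ‖c m‖) ^ 2) (𝓝[<] 1)
        (𝓝 (∑ m ∈ s, ((1 : ℝ) ^ (∑ i, m i) * ‖c m‖) ^ 2)) := by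
      refine Tendsto.mono_left (Continuous.tendsto ?_ 1) nhdsWithin_le_nhds
      fun_prop
    simp only [one_pow, one_mul] at hlim
    refine le_of_tendsto hlim ?_
    filter_upwards [Ioo_mem_nhdsLT (zero_lt_one' ℝ)] with r hr using key r ⟨hr.1.le, hr.2⟩ s
  have hcmem : Memℓp c 2 := memℓp_two_iff.mpr
    (summable_of_sum_le (fun _ => sq_nonneg _) key1)
  exact ⟨⟨c, hcmem⟩, fun z hz => (hc z hz).2.tsum_eq,
    norm_le_of_sum_sq_le (by positivity) key1⟩

/-- The multiplication operator `M_Θ : H²_F(𝔻ⁿ) → H²_E(𝔻ⁿ)`, `(M_Θ f)(z) = Θ(z) f(z)`;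
see `HInf.eval_mulOp`, which determines it by `eq_of_eval_eq`. -/
def HInf.mulOp [CompleteSpace E] [CompleteSpace F] (Θ : HInf n F E) : H2 n F →L[ℂ] H2 n E :=
  LinearMap.mkContinuousOfExistsBound
    { toFun := fun f => (Θ.exists_mul.choose_spec f).choose
      map_add' := fun f g => eq_of_eval_eq fun z hz => by
        rw [eval_add _ _ hz, (Θ.exists_mul.choose_spec _).choose_spec.1 z hz,
          (Θ.exists_mul.choose_spec _).choose_spec.1 z hz,
          (Θ.exists_mul.choose_spec _).choose_spec.1 z hz, eval_add _ _ hz, map_add]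
      map_smul' := fun a f => eq_of_eval_eq fun z hz => by
        rw [RingHom.id_apply, eval_smul _ _ hz, (Θ.exists_mul.choose_spec _).choose_spec.1 z hz,
          (Θ.exists_mul.choose_spec _).choose_spec.1 z hz, eval_smul _ _ hz, map_smul] }
    ⟨_, fun f => (Θ.exists_mul.choose_spec f).choose_spec.2⟩

theorem HInf.eval_mulOp [CompleteSpace E] [CompleteSpace F] (Θ : HInf n F E) (f : H2 n F)
    {z : Fin n → ℂ} (hz : z ∈ ball (0 : Fin n → ℂ) 1) :
    eval (Θ.mulOp f) z = Θ.toFun z (eval f z) :=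
  (Θ.exists_mul.choose_spec f).choose_spec.1 z hz

/-- `L^∞_{B(E)}(𝕋ⁿ)`: essentially bounded `B(E)`-valued functions on the torus, measurable in the
strong operator sense. -/
structure LInf (n : ℕ) (E : Type*) [NormedAddCommGroup E] [InnerProductSpace ℂ E] where
  toFun : UnitAddTorus (Fin n) → E →L[ℂ] E
  aestronglyMeasurable' : ∀ e, AEStronglyMeasurable (fun t => toFun t e) (torusMeasure n)
  bounded' : ∃ C : ℝ, ∀ᵐ t ∂torusMeasure n, ‖toFun t‖ ≤ C

theorem LInf.aestronglyMeasurable_apply (Φ : LInf n E) {f : UnitAddTorus (Fin n) → E}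
    (hf : AEStronglyMeasurable f (torusMeasure n)) :
    AEStronglyMeasurable (fun t => Φ.toFun t (f t)) (torusMeasure n) := by
  obtain ⟨g, hg, hfg⟩ := hf
  refine AEStronglyMeasurable.congr (f := fun t => Φ.toFun t (g t)) ?_ ?_
  · refine aestronglyMeasurable_of_tendsto_ae atTop (f := fun m t => Φ.toFun t (hg.approx m t)) ?_ ?_
    · intro m
      classical
      have : (fun t => Φ.toFun t (hg.approx m t)) = fun t => ∑ e ∈ (hg.approx m).range,
          ((hg.approx m) ⁻¹' {e}).indicator (fun t => Φ.toFun t e) t := by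
        funext t
        rw [Finset.sum_eq_single (hg.approx m t)]
        · simp
        · intro e _ he
          simp [Set.indicator, Ne.symm he]
        · intro h; exact absurd ((hg.approx m).mem_range_self t) h
      rw [this]
      refine Finset.aestronglyMeasurable_fun_sum _ fun e _ => ?_
      exact (Φ.aestronglyMeasurable' e).indicator ((hg.approx m).measurableSet_fiber e)
    · exact ae_of_all _ fun t => ((Φ.toFun t).continuous.tendsto _).comp (hg.tendsto_approx t)
  · filter_upwards [hfg] with t ht
    rw [ht]

theorem LInf.exists_bound (Φ : LInf n E) :
    ∃ C : ℝ, 0 ≤ C ∧ ∀ᵐ t ∂torusMeasure n, ‖Φ.toFun t‖ ≤ C := by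
  obtain ⟨C, hC⟩ := Φ.bounded'
  exact ⟨max C 0, le_max_right _ _, hC.mono fun t ht => ht.trans (le_max_left _ _)⟩

theorem LInf.memLp (Φ : LInf n E) (f : L2 n E) :
    MemLp (fun t => Φ.toFun t (f t)) 2 (torusMeasure n) := by
  obtain ⟨C, -, hC⟩ := Φ.exists_bound
  refine (Lp.memLp f).of_le_mul (c := C) (Φ.aestronglyMeasurable_apply (Lp.aestronglyMeasurable f)) ?_
  filter_upwards [hC] with t ht using (Φ.toFun t).le_of_opNorm_le ht _

/-- The Laurent operator `L_Φ f = Φ f` on `L²_E(𝕋ⁿ)`. -/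
def LInf.laurent (Φ : LInf n E) : L2 n E →L[ℂ] L2 n E :=
  LinearMap.mkContinuousOfExistsBound
    { toFun := fun f => (Φ.memLp f).toLp
      map_add' := fun f g => by
        rw [← MemLp.toLp_add]
        refine MemLp.toLp_congr _ _ ?_
        filter_upwards [Lp.coeFn_add f g] with t ht
        rw [ht, Pi.add_apply, map_add, Pi.add_apply]
      map_smul' := fun c f => by
        rw [RingHom.id_apply, ← MemLp.toLp_const_smul]
        refine MemLp.toLp_congr _ _ ?_
        filter_upwards [Lp.coeFn_smul c f] with t ht
        rw [ht, Pi.smul_apply, map_smul, Pi.smul_apply] } (by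
      obtain ⟨C, -, hC⟩ := Φ.exists_bound
      refine ⟨C, fun f => Lp.norm_le_mul_norm_of_ae_le_mul ?_⟩
      filter_upwards [hC, (Φ.memLp f).coeFn_toLp] with t ht h2
      change ‖(Φ.memLp f).toLp _ t‖ ≤ _
      rw [h2]
      exact (Φ.toFun t).le_of_opNorm_le ht _)

theorem norm_sub_dilate_sq {r : ℝ} (hr : r ∈ Set.Ico (0 : ℝ) 1) (f : H2 n E) :
    ‖dilate hr f - f‖ ^ 2 = ∑' k : Fin n → ℕ, ((1 - r ^ (∑ i, k i)) * ‖f k‖) ^ 2 := by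
  have h := lp.norm_rpow_eq_tsum (p := 2) (by norm_num) (dilate hr f - f)
  simp only [ENNReal.toReal_ofNat, Real.rpow_ofNat] at h
  rw [h]
  refine tsum_congr fun k => ?_
  have h1 : (dilate hr f - f) k = (((r ^ (∑ i, k i) - 1 : ℝ)) : ℂ) • f k := by
    rw [lp.coeFn_sub, Pi.sub_apply, dilate_apply]
    push_cast
    rw [sub_smul, one_smul]
  have h2 : r ^ (∑ i, k i) ≤ 1 := pow_le_one₀ hr.1 hr.2.le
  rw [h1, norm_smul, Complex.norm_real, Real.norm_eq_abs, abs_sub_comm,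
    abs_of_nonneg (by linarith)]

/-- The boundary function of `f ∈ H²_E(𝔻ⁿ)` is its radial limit function: at almost every point of
the torus, it is the only possible value of `lim_{r → 1-} f(r ζ)`. -/
theorem ae_eq_of_tendsto_radial [CompleteSpace E] (f : H2 n E) :
    ∀ᵐ t ∂torusMeasure n, ∀ v : E,
      Tendsto (fun r : ℝ => eval f (radialPoint r t)) (𝓝[<] 1) (𝓝 v) → boundary n E f t = v := by
  let ρ : ℕ → ℝ := fun m => 1 - 1 / ((m : ℝ) + 1)
  have hρ : ∀ m, ρ m ∈ Set.Ico (0 : ℝ) 1 := by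
    intro m
    have h1 : (0 : ℝ) < 1 / ((m : ℝ) + 1) := by positivity
    have h2 : 1 / ((m : ℝ) + 1) ≤ 1 := by
      rw [div_le_one (by positivity)]; linarith [(Nat.cast_nonneg m : (0 : ℝ) ≤ m)]
    exact ⟨by simp only [ρ]; linarith, by simp only [ρ]; linarith⟩
  have hρlim : Tendsto ρ atTop (𝓝 1) := by
    simpa [ρ] using (tendsto_one_div_add_atTop_nhds_zero_nat (𝕜 := ℝ)).const_sub 1
  have hρlim' : Tendsto ρ atTop (𝓝[<] 1) :=
    tendsto_nhdsWithin_iff.mpr ⟨hρlim, Eventually.of_forall fun m => (hρ m).2⟩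
  have hsq : Tendsto (fun m => ‖dilate (hρ m) f - f‖ ^ 2) atTop (𝓝 0) := by
    simp only [norm_sub_dilate_sq]
    have h0 : (0 : ℝ) = ∑' k : Fin n → ℕ, ((1 - (1 : ℝ) ^ (∑ i, k i)) * ‖f k‖) ^ 2 := by simp
    rw [h0]
    refine tendsto_tsum_of_dominated_convergence (bound := fun k => ‖f k‖ ^ 2)
      (memℓp_two_iff.mp (lp.memℓp f)) (fun k => ?_) (Eventually.of_forall fun m k => ?_)
    · exact (((hρlim.pow _).const_sub 1).mul_const _).pow 2
    · have h2 : ρ m ^ (∑ i, k i) ≤ 1 := pow_le_one₀ (hρ m).1 (hρ m).2.le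
      have h3 : 0 ≤ ρ m ^ (∑ i, k i) := pow_nonneg (hρ m).1 _
      rw [Real.norm_of_nonneg (sq_nonneg _)]
      refine pow_le_pow_left₀ (mul_nonneg (by linarith) (norm_nonneg _)) ?_ 2
      exact mul_le_of_le_one_left (norm_nonneg _) (by linarith)
  have hdil : Tendsto (fun m => dilate (hρ m) f) atTop (𝓝 f) := by
    rw [tendsto_iff_norm_sub_tendsto_zero]
    simpa using hsq.sqrt
  have hL2 : Tendsto (fun m => boundary n E (dilate (hρ m) f)) atTop (𝓝 (boundary n E f)) :=
    ((boundary n E).continuous.tendsto f).comp hdil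
  obtain ⟨ns, hns, hae⟩ := (tendstoInMeasure_of_tendsto_Lp hL2).exists_seq_tendsto_ae
  have hall : ∀ᵐ t ∂torusMeasure n, ∀ m,
      boundary n E (dilate (hρ m) f) t = eval f (radialPoint (ρ m) t) :=
    ae_all_iff.mpr fun m => boundary_dilate (hρ m) f
  filter_upwards [hae, hall] with t h1 h2 v hv
  simp only [h2] at h1
  exact tendsto_nhds_unique h1 (hv.comp (hρlim'.comp hns.tendsto_atTop))

open ContinuousLinearMap in
/-- The Toeplitz operator `T_Φ = P_{H²} L_Φ|_{H²}`: with `J` the isometric identification of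
`H²_E(𝔻ⁿ)` with a closed subspace of `L²_E(𝕋ⁿ)`, this is `J* L_Φ J`. -/
def LInf.toeplitz [CompleteSpace E] (Φ : LInf n E) : H2 n E →L[ℂ] H2 n E :=
  adjoint (boundary n E).toContinuousLinearMap ∘L Φ.laurent ∘L (boundary n E).toContinuousLinearMap

/-- The constant function `η` in `H²_E(𝔻ⁿ)`. -/
def const (n : ℕ) (η : E) : H2 n E := lp.single 2 0 η

theorem eval_const (η : E) (z : Fin n → ℂ) : eval (const n η) z = η := by
  rw [eval, tsum_eq_single 0]
  · simp [const, mono]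
  · intro k hk
    simp [const, hk]

/-- `Θ` is inner: its boundary values are isometries a.e. on the torus, i.e. for every `η ∈ F` the
boundary function of `z ↦ Θ(z) η` has norm `‖η‖` a.e. For separable `F`, taking a countable dense
set of vectors makes the exceptional null set independent of `η`; for arbitrary `F`, boundary values
are only determined vector by vector. -/
def HInf.IsInner [CompleteSpace E] [CompleteSpace F] (Θ : HInf n F E) : Prop :=
  ∀ η : F, ∀ᵐ t ∂torusMeasure n, ‖boundary n E (Θ.mulOp (const n η)) t‖ = ‖η‖

/-- `T` is isometric on the orthogonal complement of its kernel. -/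
def IsPartialIsometry {H : Type*} [NormedAddCommGroup H] [InnerProductSpace ℂ H]
    (T : H →L[ℂ] H) : Prop :=
  ∀ x ∈ (LinearMap.ker (T : H →ₗ[ℂ] H))ᗮ, ‖T x‖ = ‖x‖

/-- `T T* ≤ T* T` for the usual order of self-adjoint operators. -/
def IsHyponormal {H : Type*} [NormedAddCommGroup H] [InnerProductSpace ℂ H] [CompleteSpace H]
    (T : H →L[ℂ] H) : Prop :=
  T ∘L ContinuousLinearMap.adjoint T ≤ ContinuousLinearMap.adjoint T ∘L T

end
end PolydiscHardy

namespace PolydiscHardy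

set_option linter.unusedSectionVars false
open MeasureTheory Filter Topology Metric ContinuousLinearMap
open scoped ENNReal InnerProductSpace

noncomputable section

/-! ### Multiplication by monomials, its adjoint, and the Brown–Halmos identity -/

section Shift

variable {n : ℕ} {E : Type*} [NormedAddCommGroup E] [InnerProductSpace ℂ E] [CompleteSpace E]
  {G : Type*} [NormedAddCommGroup G] [NormedSpace ℂ G]

/-! Write `M_k` for multiplication by `z^k`, `T` for the Toeplitz operator and `N = (ker T)^⊥`. The
only property of Toeplitz operators used is the Brown–Halmos identity `M_k^* T M_k = T`
(`backshift_toeplitz_shift`). For `f ∈ N` it gives `‖f‖ = ‖T f‖ = ‖M_k^* T M_k f‖ ≤ ‖T M_k f‖ ≤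
‖f‖`. Equality throughout means that `N` is invariant under `M_k` and that `T M_k = M_k T` on `N`
(`shift_mem_initialSpace`, `toeplitz_shift`).

An invariant subspace of the polydisc shifts need not have the form `Ψ H²`; it does when the
restricted shifts `R_k = M_k|_N` doubly commute. This is the heart of the proof
(`initialCoshift_shift_eq_zero`), and it holds for every partially isometric `T` with the
Brown–Halmos identity, hyponormal or not. A Wold decomposition in several variables
(`DoublyCommutingShifts.model`) then identifies `N` with `H²_F`, where `F` is the joint wandering
subspace, through an isometry `V` intertwining the shifts. Such isometries are exactly the
multiplications by inner functions (`exists_isInner_mulOp_eq`, `HInf.IsInner.norm_mulOp`), so `V =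
M_Ψ`.

Hyponormality forces `ker T ⊆ ker T^*`, hence `ran T ⊆ N`. So `V⁻¹ T V` is an isometry of `H²_F`
commuting with the shifts, that is, some `M_Θ`; since `T` vanishes off `N`, `T = M_Ψ M_Θ M_Ψ^*`.
Conversely, for a product of this form `‖T^* f‖ = ‖M_Θ^* M_Ψ^* f‖ ≤ ‖M_Ψ^* f‖ = ‖T f‖`. -/

/-- Bounded operators on `H²` are determined by their values on monomials. -/
theorem clm_eq_of_single {A B : H2 n E →L[ℂ] G}
    (h : ∀ k a, A (lp.single 2 k a) = B (lp.single 2 k a)) : A = B := by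
  ext f
  have hf := lp.hasSum_single (p := 2) (by norm_num) f
  refine (hf.mapL A).unique ?_
  simpa only [h] using hf.mapL B

/-- The isometry `a ↦ a z^k` of `E` into `H²_E(𝔻ⁿ)`. -/
def singleIsometry (n : ℕ) (E : Type*) [NormedAddCommGroup E] [InnerProductSpace ℂ E]
    (k : Fin n → ℕ) : E →ₗᵢ[ℂ] H2 n E where
  toFun a := lp.single (E := fun _ : Fin n → ℕ => E) 2 k a
  map_add' a b := lp.single_add (E := fun _ : Fin n → ℕ => E) 2 k a b
  map_smul' c a := lp.single_smul (E := fun _ : Fin n → ℕ => E) 2 k c a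
  norm_map' a := lp.norm_single (E := fun _ : Fin n → ℕ => E) (p := 2) two_pos k a

theorem singleIsometry_apply (k : Fin n → ℕ) (a : E) :
    singleIsometry n E k a = lp.single 2 k a := rfl

theorem inner_single (k : Fin n → ℕ) (a : E) (f : H2 n E) :
    ⟪(lp.single 2 k a : H2 n E), f⟫_ℂ = ⟪a, f k⟫_ℂ :=
  lp.inner_single_left k a f

theorem inner_single_single (k l : Fin n → ℕ) (a b : E) :
    ⟪(lp.single 2 k a : H2 n E), lp.single 2 l b⟫_ℂ = if k = l then ⟪a, b⟫_ℂ else 0 := by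
  rw [inner_single, lp.single_apply]
  split_ifs with h
  · subst h; rw [Pi.single_eq_same]
  · rw [Pi.single_eq_of_ne h, inner_zero_right]

theorem orthogonalFamily_singleIsometry_add (m : Fin n → ℕ) :
    OrthogonalFamily ℂ (fun _ : Fin n → ℕ => E) fun k => singleIsometry n E (k + m) := by
  intro k l hkl a b
  simp only [singleIsometry_apply]
  rw [inner_single_single, if_neg fun h => hkl (add_right_cancel h)]

/-- Multiplication by `z^m` on `H²_E(𝔻ⁿ)`. -/
def shift (n : ℕ) (E : Type*) [NormedAddCommGroup E] [InnerProductSpace ℂ E] [CompleteSpace E]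
    (m : Fin n → ℕ) : H2 n E →ₗᵢ[ℂ] H2 n E :=
  (orthogonalFamily_singleIsometry_add (n := n) (E := E) m).linearIsometry

theorem shift_single (m k : Fin n → ℕ) (a : E) :
    shift n E m (lp.single 2 k a) = lp.single 2 (k + m) a := by
  rw [← singleIsometry_apply (k + m)]
  exact (orthogonalFamily_singleIsometry_add (n := n) (E := E) m).linearIsometry_apply_single a

theorem shift_const (m : Fin n → ℕ) (a : E) : shift n E m (const n a) = lp.single 2 m a := by
  rw [const, shift_single, zero_add]

theorem shift_zero (f : H2 n E) : shift n E 0 f = f := by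
  have : (shift n E 0).toContinuousLinearMap = ContinuousLinearMap.id ℂ (H2 n E) :=
    clm_eq_of_single fun k a => by simp [shift_single]
  exact congr($this f)

theorem shift_add (k l : Fin n → ℕ) (f : H2 n E) :
    shift n E (k + l) f = shift n E k (shift n E l f) := by
  have : (shift n E (k + l)).toContinuousLinearMap =
      (shift n E k).toContinuousLinearMap ∘L (shift n E l).toContinuousLinearMap :=
    clm_eq_of_single fun m a => by simp [shift_single, add_comm k l, add_assoc]
  exact congr($this f)

/-- The adjoint of multiplication by `z^m` on `H²_E(𝔻ⁿ)`. -/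
def backshift (n : ℕ) (E : Type*) [NormedAddCommGroup E] [InnerProductSpace ℂ E] [CompleteSpace E]
    (m : Fin n → ℕ) : H2 n E →L[ℂ] H2 n E :=
  adjoint (shift n E m).toContinuousLinearMap

theorem inner_backshift_left (m : Fin n → ℕ) (f g : H2 n E) :
    ⟪backshift n E m f, g⟫_ℂ = ⟪f, shift n E m g⟫_ℂ :=
  adjoint_inner_left _ _ _

theorem inner_backshift_right (m : Fin n → ℕ) (f g : H2 n E) :
    ⟪f, backshift n E m g⟫_ℂ = ⟪shift n E m f, g⟫_ℂ :=
  adjoint_inner_right _ _ _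

theorem backshift_shift (m : Fin n → ℕ) (f : H2 n E) :
    backshift n E m (shift n E m f) = f :=
  ext_inner_left ℂ fun g => by rw [inner_backshift_right, LinearIsometry.inner_map_map]

theorem backshift_apply (m : Fin n → ℕ) (f : H2 n E) (k : Fin n → ℕ) :
    backshift n E m f k = f (k + m) :=
  ext_inner_left ℂ fun a : E => by
    rw [← inner_single, inner_backshift_right, shift_single, inner_single]

theorem norm_backshift_le (m : Fin n → ℕ) (f : H2 n E) : ‖backshift n E m f‖ ≤ ‖f‖ := by
  refine ((adjoint (shift n E m).toContinuousLinearMap).le_of_opNorm_le ?_ f).trans (one_mul _).le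
  rw [LinearIsometryEquiv.norm_map]
  exact (shift n E m).norm_toContinuousLinearMap_le

theorem backshift_single_of_not_le {m k : Fin n → ℕ} (h : ¬ m ≤ k) (a : E) :
    backshift n E m (lp.single 2 k a) = 0 := by
  ext l
  rw [backshift_apply, lp.single_apply, Pi.single_eq_of_ne]
  · rfl
  · rintro rfl
    exact h le_add_self

theorem backshift_single_add (m k : Fin n → ℕ) (a : E) :
    backshift n E m (lp.single 2 (k + m) a) = lp.single 2 k a := by
  rw [← shift_single, backshift_shift]

theorem shift_apply_of_not_le {m k : Fin n → ℕ} (h : ¬ m ≤ k) (f : H2 n E) :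
    shift n E m f k = 0 :=
  ext_inner_left ℂ fun a : E => by
    rw [← inner_single, ← inner_backshift_left, backshift_single_of_not_le h,
      inner_zero_left, inner_zero_right]

/-- Double commutation on the whole of `H²`: since `z^k` does not involve `z_i`, a monomial `z^l` is
divisible by `z_i` exactly when `z^(l+k)` is. -/
theorem backshift_shift_comm {i : Fin n} {k : Fin n → ℕ} (hk : k i = 0) (f : H2 n E) :
    backshift n E (Pi.single i 1) (shift n E k f) =
      shift n E k (backshift n E (Pi.single i 1) f) := by
  have : backshift n E (Pi.single i 1) ∘L (shift n E k).toContinuousLinearMap =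
      (shift n E k).toContinuousLinearMap ∘L backshift n E (Pi.single i 1) := by
    refine clm_eq_of_single fun l a => ?_
    simp only [ContinuousLinearMap.comp_apply, LinearIsometry.coe_toContinuousLinearMap,
      shift_single]
    by_cases hl : Pi.single i 1 ≤ l
    · obtain ⟨l, rfl⟩ := exists_add_of_le hl
      rw [add_comm _ l, add_right_comm, backshift_single_add, backshift_single_add, shift_single]
    · rw [backshift_single_of_not_le hl, backshift_single_of_not_le, map_zero]
      intro h
      have h1 := h i
      rw [Pi.single_eq_same, Pi.add_apply, hk, add_zero] at h1
      refine hl fun j => ?_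
      rcases eq_or_ne j i with rfl | hj
      · rwa [Pi.single_eq_same]
      · rw [Pi.single_eq_of_ne hj]
        exact Nat.zero_le _
  exact congr($this f)

/-- The coordinate shifts of `H²_E(𝔻ⁿ)` are pure. -/
theorem eq_zero_of_mem_range_shift (i : Fin n) {f : H2 n E}
    (h : ∀ m : ℕ, f ∈ Set.range (shift n E (m • Pi.single i 1))) : f = 0 := by
  ext k
  -- A multiple of `z_i^(k i + 1)` has no `z^k` term.
  obtain ⟨g, rfl⟩ := h (k i + 1)
  refine shift_apply_of_not_le (fun hle => ?_) g
  have := hle i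
  simp at this

/-- The character `ζ^k` as a scalar element of `L^∞_{B(E)}(𝕋ⁿ)`. -/
def characterLInf (n : ℕ) (E : Type*) [NormedAddCommGroup E] [InnerProductSpace ℂ E]
    (k : Fin n → ℕ) : LInf n E where
  toFun t := character k t • ContinuousLinearMap.id ℂ E
  aestronglyMeasurable' e :=
    (show Continuous fun t => character k t • e by fun_prop).aestronglyMeasurable
  bounded' := ⟨‖character k‖ * ‖ContinuousLinearMap.id ℂ E‖, ae_of_all _ fun t => by
    rw [norm_smul]
    exact mul_le_mul_of_nonneg_right ((character k).norm_coe_le_norm t) (norm_nonneg _)⟩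

theorem LInf.coeFn_laurent (Φ : LInf n E) (f : L2 n E) :
    Φ.laurent f =ᵐ[torusMeasure n] fun t => Φ.toFun t (f t) :=
  (Φ.memLp f).coeFn_toLp

theorem norm_character (k : Fin n → ℕ) (t : UnitAddTorus (Fin n)) : ‖character k t‖ = 1 := by
  simp [character, UnitAddTorus.mFourier, fourier_apply, norm_prod, Circle.norm_coe]

theorem character_add (k l : Fin n → ℕ) (t : UnitAddTorus (Fin n)) :
    character (k + l) t = character k t * character l t := by
  rw [character, ← UnitAddTorus.mFourier_add]
  congr 2

theorem boundary_single (k : Fin n → ℕ) (a : E) :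
    boundary n E (lp.single 2 k a) = monomialL2 n E k a :=
  orthogonalFamily_monomialL2.linearIsometry_apply_single a

theorem coeFn_monomialL2 (k : Fin n → ℕ) (a : E) :
    monomialL2 n E k a =ᵐ[torusMeasure n] fun t => character k t • a :=
  ContinuousMap.coeFn_toLp (𝕜 := ℂ) (p := 2) (torusMeasure n) (monomialC k a)

/-- On the boundary, the shift is multiplication by a character. -/
theorem boundary_shift (k : Fin n → ℕ) (f : H2 n E) :
    boundary n E (shift n E k f) =ᵐ[torusMeasure n] fun t => character k t • boundary n E f t := by
  have h : (boundary n E).toContinuousLinearMap ∘L (shift n E k).toContinuousLinearMap =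
      (characterLInf n E k).laurent ∘L (boundary n E).toContinuousLinearMap := by
    refine clm_eq_of_single fun l a => ?_
    simp only [ContinuousLinearMap.comp_apply, LinearIsometry.coe_toContinuousLinearMap,
      shift_single, boundary_single]
    refine Lp.ext ?_
    filter_upwards [coeFn_monomialL2 (l + k) a, coeFn_monomialL2 l a,
      (characterLInf n E k).coeFn_laurent (monomialL2 n E l a)] with t h1 h2 h3
    rw [h1, h3, h2]
    simp [characterLInf, smul_smul, character_add, mul_comm]
  have h2 : boundary n E (shift n E k f) = (characterLInf n E k).laurent (boundary n E f) :=
    congr($h f)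
  rw [h2]
  exact (characterLInf n E k).coeFn_laurent _

theorem inner_toeplitz (Φ : LInf n E) (f g : H2 n E) :
    ⟪f, Φ.toeplitz g⟫_ℂ =
      ∫ t, ⟪boundary n E f t, Φ.toFun t (boundary n E g t)⟫_ℂ ∂torusMeasure n := by
  rw [LInf.toeplitz, ContinuousLinearMap.comp_apply, adjoint_inner_right,
    MeasureTheory.L2.inner_def]
  refine integral_congr_ae ?_
  filter_upwards [Φ.coeFn_laurent (boundary n E g)] with t ht
  simp only [ContinuousLinearMap.comp_apply, LinearIsometry.coe_toContinuousLinearMap, ht]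

/-- Toeplitz operators satisfy the Brown–Halmos identity. -/
theorem backshift_toeplitz_shift (Φ : LInf n E) (k : Fin n → ℕ) (f : H2 n E) :
    backshift n E k (Φ.toeplitz (shift n E k f)) = Φ.toeplitz f := by
  refine ext_inner_left ℂ fun g => ?_
  rw [inner_backshift_right, inner_toeplitz, inner_toeplitz]
  refine integral_congr_ae ?_
  filter_upwards [boundary_shift k f, boundary_shift k g] with t h1 h2
  simp only [h1, h2, map_smul, inner_smul_left, inner_smul_right, ← mul_assoc]
  -- The two characters cancel under the integral because `|ζ^k| = 1`.
  rw [mul_comm ((character k) t), RCLike.conj_mul, norm_character]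
  simp

end Shift

/-! ### Wold decomposition for doubly commuting pure isometries -/

/-- A doubly commuting system of pure isometries on a Hilbert space, indexed by monomials. -/
structure DoublyCommutingShifts (n : ℕ) (K : Type*) [NormedAddCommGroup K] [InnerProductSpace ℂ K]
    [CompleteSpace K] where
  op : (Fin n → ℕ) → K →ₗᵢ[ℂ] K
  op_zero : ∀ x, op 0 x = x
  op_add : ∀ k l x, op (k + l) x = op k (op l x)
  adjoint_op_comm : ∀ i k, k i = 0 → ∀ x,
    adjoint (op (Pi.single i 1)).toContinuousLinearMap (op k x) =
      op k (adjoint (op (Pi.single i 1)).toContinuousLinearMap x)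
  pure : ∀ i x, (∀ m : ℕ, x ∈ Set.range (op (m • Pi.single i 1))) → x = 0

namespace DoublyCommutingShifts

variable {n : ℕ} {K : Type*} [NormedAddCommGroup K] [InnerProductSpace ℂ K] [CompleteSpace K]
  (R : DoublyCommutingShifts n K)

/-- The adjoints of the shifts. -/
def coop (k : Fin n → ℕ) : K →L[ℂ] K := adjoint (R.op k).toContinuousLinearMap

theorem inner_coop_left (k : Fin n → ℕ) (x y : K) : ⟪R.coop k x, y⟫_ℂ = ⟪x, R.op k y⟫_ℂ :=
  adjoint_inner_left _ _ _

theorem inner_coop_right (k : Fin n → ℕ) (x y : K) : ⟪x, R.coop k y⟫_ℂ = ⟪R.op k x, y⟫_ℂ :=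
  adjoint_inner_right _ _ _

theorem coop_op (k : Fin n → ℕ) (x : K) : R.coop k (R.op k x) = x :=
  ext_inner_left ℂ fun y => by rw [inner_coop_right, LinearIsometry.inner_map_map]

theorem coop_add (k l : Fin n → ℕ) (x : K) : R.coop (k + l) x = R.coop k (R.coop l x) :=
  ext_inner_left ℂ fun y => by
    rw [inner_coop_right, inner_coop_right, inner_coop_right, add_comm, R.op_add]

theorem coop_comm (k l : Fin n → ℕ) (x : K) :
    R.coop k (R.coop l x) = R.coop l (R.coop k x) := by
  rw [← coop_add, ← coop_add, add_comm]

theorem coop_op_comm {i : Fin n} {k : Fin n → ℕ} (hk : k i = 0) (x : K) :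
    R.coop (Pi.single i 1) (R.op k x) = R.op k (R.coop (Pi.single i 1) x) :=
  R.adjoint_op_comm i k hk x

/-- The joint wandering subspace. -/
def wandering : Submodule ℂ K := ⨅ i, LinearMap.ker (R.coop (Pi.single i 1) : K →ₗ[ℂ] K)

theorem mem_wandering {x : K} : x ∈ R.wandering ↔ ∀ i, R.coop (Pi.single i 1) x = 0 := by
  simp [wandering, Submodule.mem_iInf]

theorem isClosed_wandering : IsClosed (R.wandering : Set K) := by
  rw [wandering, Submodule.coe_iInf]
  exact isClosed_iInter fun i => (R.coop (Pi.single i 1)).isClosed_ker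

instance : CompleteSpace R.wandering := R.isClosed_wandering.completeSpace_coe

/-- After cancelling the common isometric factor of exponent `k ⊓ l`, the left exponent is `0` at
`i` while the right one still contains a factor `z_i`. Moved to the left, the adjoint of that factor
passes through by double commutation and kills the wandering vector `a`. -/
theorem inner_op_op_eq_zero_of_lt {k l : Fin n → ℕ} {i : Fin n} (h : k i < l i) {a b : K}
    (ha : a ∈ R.wandering) : ⟪R.op k a, R.op l b⟫_ℂ = 0 := by
  obtain ⟨m, k', l', rfl, rfl, hk'⟩ : ∃ m k' l' : Fin n → ℕ,
      k = m + k' ∧ l = m + (Pi.single i 1 + l') ∧ k' i = 0 := by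
    refine ⟨k ⊓ l, k - k ⊓ l, l - k ⊓ l - Pi.single i 1,
      (add_tsub_cancel_of_le inf_le_left).symm, ?_, ?_⟩
    · rw [add_tsub_cancel_of_le, add_tsub_cancel_of_le inf_le_right]
      intro j
      rcases eq_or_ne j i with rfl | hj
      · simp only [Pi.single_eq_same, Pi.sub_apply, Pi.inf_apply]
        omega
      · rw [Pi.single_eq_of_ne hj]
        exact Nat.zero_le _
    · simp only [Pi.sub_apply, Pi.inf_apply]
      omega
  rw [R.op_add, R.op_add m, LinearIsometry.inner_map_map, R.op_add, ← R.inner_coop_left,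
    R.coop_op_comm hk', R.mem_wandering.mp ha, map_zero, inner_zero_left]

theorem orthogonalFamily :
    OrthogonalFamily ℂ (fun _ : Fin n → ℕ => R.wandering)
      fun k => (R.op k).comp R.wandering.subtypeₗᵢ := by
  intro k l hkl a b
  obtain ⟨i, hi⟩ := Function.ne_iff.mp hkl
  rcases lt_or_gt_of_ne hi with hi | hi
  · exact R.inner_op_op_eq_zero_of_lt hi a.2
  · exact inner_eq_zero_symm.mp (R.inner_op_op_eq_zero_of_lt hi b.2)

/-- Induction on the set `s` of coordinates whose adjoint shift is not yet known to kill `y`. When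
`s` is empty, `y` is itself wandering, hence orthogonal to itself. Each further coordinate is
handled by the one-variable Wold argument, which ends in purity. -/
theorem eq_zero_of_orthogonal_aux (s : Finset (Fin n)) :
    ∀ y : K, (∀ i ∉ s, R.coop (Pi.single i 1) y = 0) →
      (∀ k, ∀ a ∈ R.wandering, ⟪R.op k a, y⟫_ℂ = 0) → y = 0 := by
  induction s using Finset.induction_on with
  | empty =>
    intro y hy h
    have := h 0 y (R.mem_wandering.mpr fun i => hy i (Finset.notMem_empty i))
    rwa [R.op_zero, inner_self_eq_zero] at this
  | insert i s his ih =>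
    intro y hy h
    set e : Fin n → ℕ := Pi.single i 1
    have hcoop : ∀ l k, ∀ a ∈ R.wandering, ⟪R.op k a, R.coop l y⟫_ℂ = 0 := fun l k a ha => by
      rw [R.inner_coop_right, ← R.op_add, h _ a ha]
    -- The difference of the two sides is the component of `R_i^{*m} y` in `ker R_i^*`. It is killed
    -- by one adjoint shift more than `y` is known to be, and it is still orthogonal to all shifted
    -- wandering vectors, so the induction hypothesis applies to it.
    have key : ∀ m : ℕ, R.coop (m • e) y = R.op e (R.coop e (R.coop (m • e) y)) := by
      intro m
      rw [← sub_eq_zero]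
      refine ih _ (fun j hj => ?_) fun k a ha => ?_
      · rcases eq_or_ne j i with rfl | hji
        · rw [map_sub, R.coop_op, sub_self]
        · have hj0 : R.coop (Pi.single j 1) y = 0 := hy j (by simp [hji, hj])
          rw [map_sub, R.coop_op_comm (by simp [e, hji]), R.coop_comm _ e, R.coop_comm _ (m • e),
            hj0, map_zero, map_zero, map_zero, sub_self]
      · rw [inner_sub_right, hcoop _ _ _ ha, zero_sub, neg_eq_zero, ← R.coop_add]
        by_cases hk : k i = 0
        · rw [← R.inner_coop_left, R.coop_op_comm hk, R.mem_wandering.mp ha, map_zero,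
            inner_zero_left]
        · have hle : e ≤ k := by
            intro j
            rcases eq_or_ne j i with rfl | hj
            · simpa [e] using Nat.one_le_iff_ne_zero.mpr hk
            · simp [e, hj]
          rw [← add_tsub_cancel_of_le hle, R.op_add, LinearIsometry.inner_map_map, hcoop _ _ _ ha]
    -- Iterating `key` gives `y = R_i^m R_i^{*m} y`, so `y` lies in the range of every power of
    -- `R_i`.
    refine R.pure i y fun m => ⟨R.coop (m • e) y, ?_⟩
    induction m with
    | zero =>
      rw [zero_smul, R.op_zero]
      exact ext_inner_left ℂ fun x => by rw [R.inner_coop_right, R.op_zero]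
    | succ m ihm =>
      have h1 : (m + 1) • e = m • e + e := succ_nsmul e m
      conv_rhs => rw [← ihm, key m]
      rw [h1, R.op_add, add_comm, R.coop_add]

theorem eq_zero_of_orthogonal {y : K} (h : ∀ k, ∀ a ∈ R.wandering, ⟪R.op k a, y⟫_ℂ = 0) :
    y = 0 :=
  R.eq_zero_of_orthogonal_aux Finset.univ y (fun i hi => absurd (Finset.mem_univ i) hi) h

/-- The canonical model: the shifts `R` are those of `H²` with values in the wandering subspace. -/
def model : H2 n R.wandering →ₗᵢ[ℂ] K := R.orthogonalFamily.linearIsometry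

theorem model_single (k : Fin n → ℕ) (a : R.wandering) :
    R.model (lp.single 2 k a) = R.op k a :=
  R.orthogonalFamily.linearIsometry_apply_single a

theorem model_shift (k : Fin n → ℕ) (f : H2 n R.wandering) :
    R.model (shift n R.wandering k f) = R.op k (R.model f) := by
  have : R.model.toContinuousLinearMap ∘L (shift n R.wandering k).toContinuousLinearMap =
      (R.op k).toContinuousLinearMap ∘L R.model.toContinuousLinearMap :=
    clm_eq_of_single fun l a => by simp [shift_single, model_single, add_comm l, R.op_add]
  exact congr($this f)

theorem model_surjective : Function.Surjective R.model := by
  have hc : IsClosed (LinearMap.range R.model.toLinearMap : Set K) := by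
    rw [LinearMap.coe_range]
    exact R.model.isometry.isClosedEmbedding.isClosed_range
  have : CompleteSpace (LinearMap.range R.model.toLinearMap) := hc.completeSpace_coe
  -- The range of an isometry is closed, so density suffices.
  refine LinearMap.range_eq_top.mp ((Submodule.orthogonal_eq_bot_iff (𝕜 := ℂ)).mp ?_)
  refine (Submodule.eq_bot_iff _).mpr fun y hy => R.eq_zero_of_orthogonal fun k a ha => ?_
  refine hy _ ⟨lp.single 2 k ⟨a, ha⟩, ?_⟩
  exact R.model_single k ⟨a, ha⟩

end DoublyCommutingShifts

/-! ### Point evaluations, and isometries intertwining the shifts -/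

section Eval

variable {n : ℕ} {E : Type*} [NormedAddCommGroup E] [InnerProductSpace ℂ E] [CompleteSpace E]
  {F : Type*} [NormedAddCommGroup F] [InnerProductSpace ℂ F] [CompleteSpace F]

/-- Point evaluation on `H²_E(𝔻ⁿ)`. -/
def evalCLM {z : Fin n → ℂ} (hz : z ∈ ball (0 : Fin n → ℂ) 1) : H2 n E →L[ℂ] E :=
  LinearMap.mkContinuous
    { toFun := fun f => eval f z
      map_add' := fun f g => eval_add f g hz
      map_smul' := fun c f => eval_smul c f hz } (∑' k, ‖mono z k‖) fun f => by
    change ‖eval f z‖ ≤ _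
    refine (norm_tsum_le_tsum_norm (summable_norm_eval f hz)).trans ?_
    rw [← tsum_mul_right]
    refine (summable_norm_eval f hz).tsum_le_tsum (fun k => ?_)
      ((summable_norm_mono hz).mul_right ‖f‖)
    rw [norm_smul]
    exact mul_le_mul_of_nonneg_left (lp.norm_apply_le_norm two_ne_zero f k) (norm_nonneg _)

theorem evalCLM_apply {z : Fin n → ℂ} (hz : z ∈ ball (0 : Fin n → ℂ) 1) (f : H2 n E) :
    evalCLM hz f = eval f z := rfl

theorem eval_single (k : Fin n → ℕ) (a : E) (z : Fin n → ℂ) :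
    eval (lp.single 2 k a : H2 n E) z = mono z k • a := by
  rw [eval, tsum_eq_single k]
  · rw [lp.single_apply, Pi.single_eq_same]
  · intro l hl
    rw [lp.single_apply, Pi.single_eq_of_ne hl, smul_zero]

theorem mono_add (z : Fin n → ℂ) (k l : Fin n → ℕ) : mono z (k + l) = mono z k * mono z l := by
  simp [mono, pow_add, Finset.prod_mul_distrib]

theorem mono_single_one (z : Fin n → ℂ) (i : Fin n) : mono z (Pi.single i 1) = z i := by
  rw [mono, Finset.prod_eq_single i]
  · simp
  · intro j _ hj
    rw [Pi.single_eq_of_ne hj, pow_zero]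
  · simp

theorem eval_shift (m : Fin n → ℕ) (f : H2 n E) {z : Fin n → ℂ}
    (hz : z ∈ ball (0 : Fin n → ℂ) 1) : eval (shift n E m f) z = mono z m • eval f z := by
  have : evalCLM hz ∘L (shift n E m).toContinuousLinearMap = mono z m • evalCLM hz :=
    clm_eq_of_single fun k a => by
      simp [shift_single, evalCLM_apply, eval_single, mono_add, smul_smul, mul_comm]
  exact congr($this f)

theorem apply_mem_ball {z : Fin n → ℂ} (hz : z ∈ ball (0 : Fin n → ℂ) 1) (i : Fin n) :
    ‖z i‖ < 1 :=
  (norm_le_pi_norm z i).trans_lt (mem_ball_zero_iff.mp hz)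

theorem mem_ball_of_norm_le {z w : Fin n → ℂ} (hz : z ∈ ball (0 : Fin n → ℂ) 1)
    (h : ∀ i, ‖w i‖ ≤ ‖z i‖) : w ∈ ball (0 : Fin n → ℂ) 1 :=
  mem_ball_zero_iff.mpr <| (pi_norm_lt_iff one_pos).mpr fun i => (h i).trans_lt (apply_mem_ball hz i)

theorem norm_update_zero_le (z : Fin n → ℂ) (i j : Fin n) :
    ‖Function.update z i 0 j‖ ≤ ‖z j‖ := by
  rcases eq_or_ne j i with rfl | h
  · simp
  · rw [Function.update_of_ne h]

/-- Subtracting `z_i M_i^* f` from `f` amounts to setting `z_i = 0` in the value at `z`. -/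
theorem eval_sub_backshift (i : Fin n) (f : H2 n E) {z : Fin n → ℂ}
    (hz : z ∈ ball (0 : Fin n → ℂ) 1) :
    eval (f - z i • backshift n E (Pi.single i 1) f) z = eval f (Function.update z i 0) := by
  have hw := mem_ball_of_norm_le hz (norm_update_zero_le z i)
  have : evalCLM hz ∘L (ContinuousLinearMap.id ℂ (H2 n E) - z i • backshift n E (Pi.single i 1)) =
      evalCLM hw := by
    refine clm_eq_of_single fun k a => ?_
    simp only [ContinuousLinearMap.comp_apply, sub_apply, smul_apply,
      ContinuousLinearMap.id_apply, map_sub, map_smul, evalCLM_apply, eval_single]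
    by_cases hk : k i = 0
    · rw [backshift_single_of_not_le, ← evalCLM_apply hz, map_zero, smul_zero, sub_zero]
      · congr 1
        refine Finset.prod_congr rfl fun j _ => ?_
        rcases eq_or_ne j i with rfl | h
        · rw [hk, pow_zero, pow_zero]
        · rw [Function.update_of_ne h]
      · intro h
        have := h i
        rw [Pi.single_eq_same, hk] at this
        exact Nat.not_succ_le_zero _ this
    · obtain ⟨l, rfl⟩ : ∃ l, k = l + Pi.single i 1 := by
        refine ⟨k - Pi.single i 1, (tsub_add_cancel_of_le fun j => ?_).symm⟩
        rcases eq_or_ne j i with rfl | h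
        · rw [Pi.single_eq_same]
          exact Nat.one_le_iff_ne_zero.mpr hk
        · rw [Pi.single_eq_of_ne h]
          exact Nat.zero_le _
      rw [backshift_single_add, eval_single, mono_add, mono_add, mono_single_one, mono_single_one,
        Function.update_self, mul_zero, zero_smul, smul_smul, mul_comm, sub_self]
  exact congr($this f)

theorem norm_smul_backshift_lt_one {z : Fin n → ℂ} (hz : z ∈ ball (0 : Fin n → ℂ) 1) (i : Fin n)
    (m : Fin n → ℕ) : ‖z i • backshift n E m‖ < 1 := by
  refine lt_of_le_of_lt ?_ (apply_mem_ball hz i)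
  rw [norm_smul]
  refine mul_le_of_le_one_right (norm_nonneg _) (opNorm_le_bound _ zero_le_one fun f => ?_)
  rw [one_mul]
  exact norm_backshift_le m f

/-- Variables are set to zero one at a time. By `eval_sub_backshift`, with `g = (1 - z_i M_i^*)⁻¹
f`, the value of `f` at `z` is that of `g` at `z` with `z_i` replaced by `0`. The inverse exists
because `‖z_i M_i^*‖ < 1`, and it is analytic in operator norm; this yields norm analyticity of
symbols without summing power series. -/
theorem exists_analytic_eval (s : Finset (Fin n)) :
    ∃ A : (Fin n → ℂ) → (H2 n E →L[ℂ] H2 n E), AnalyticOnNhd ℂ A (ball 0 1) ∧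
      ∀ z ∈ ball (0 : Fin n → ℂ) 1, ∀ f,
        eval f z = eval (A z f) (fun i => if i ∈ s then 0 else z i) := by
  induction s using Finset.induction_on with
  | empty => exact ⟨fun _ => 1, analyticOnNhd_const, fun z _ f => by simp⟩
  | insert i s his ih =>
    obtain ⟨A, hA, hAe⟩ := ih
    let D : (Fin n → ℂ) → (H2 n E →L[ℂ] H2 n E) := fun z => 1 - z i • backshift n E (Pi.single i 1)
    have hD : ∀ z ∈ ball (0 : Fin n → ℂ) 1, IsUnit (D z) := fun z hz =>
      isUnit_one_sub_of_norm_lt_one (norm_smul_backshift_lt_one hz i _)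
    have hDa : AnalyticOnNhd ℂ D (ball 0 1) := fun z _ =>
      analyticAt_const.sub (((ContinuousLinearMap.proj (R := ℂ) (φ := fun _ : Fin n => ℂ)
        i).analyticAt z).smul analyticAt_const)
    refine ⟨fun z => Ring.inverse (D z) * A z, fun z hz => ?_, fun z hz f => ?_⟩
    · exact (AnalyticAt.comp (g := Ring.inverse) (analyticOnNhd_inverse (𝕜 := ℂ) _ (hD z hz))
        (hDa z hz)).mul (hA z hz)
    · rw [hAe z hz]
      set w : Fin n → ℂ := fun j => if j ∈ s then 0 else z j
      have hw : w ∈ ball (0 : Fin n → ℂ) 1 := by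
        refine mem_ball_of_norm_le hz fun j => ?_
        simp only [w]
        split_ifs <;> simp
      have hwi : w i = z i := if_neg his
      have hup : (fun j => if j ∈ insert i s then 0 else z j) = Function.update w i 0 := by
        ext j
        rcases eq_or_ne j i with rfl | h
        · simp
        · simp [w, h]
      have hmul : A z f = D z (Ring.inverse (D z) (A z f)) :=
        congr($((Ring.mul_inverse_cancel _ (hD z hz)).symm) (A z f))
      rw [hup]
      conv_lhs => rw [hmul]
      rw [mul_apply_eq_comp, ← eval_sub_backshift i _ hw, hwi]
      rfl

/-- `z ↦ f(z)` depends analytically on `z`, uniformly in `f`. -/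
theorem exists_analytic_evalCLM :
    ∃ A : (Fin n → ℂ) → (H2 n E →L[ℂ] E), AnalyticOnNhd ℂ A (ball 0 1) ∧
      ∀ z ∈ ball (0 : Fin n → ℂ) 1, ∀ f, A z f = eval f z := by
  obtain ⟨A, hA, hAe⟩ := exists_analytic_eval (n := n) (E := E) Finset.univ
  have h0 : (0 : Fin n → ℂ) ∈ ball (0 : Fin n → ℂ) 1 := mem_ball_self one_pos
  refine ⟨fun z => evalCLM h0 ∘L A z, fun z hz => ?_, fun z hz f => ?_⟩
  · exact ((compL ℂ (H2 n E) (H2 n E) E (evalCLM h0)).analyticAt _).comp (hA z hz)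
  · rw [hAe z hz]
    simp only [Finset.mem_univ, if_true]
    rfl

/-! ### The Szegő kernel and the bound on the symbol -/

theorem summable_norm_mono_sq {z : Fin n → ℂ} (hz : z ∈ ball (0 : Fin n → ℂ) 1) :
    Summable fun k : Fin n → ℕ => ‖mono z k‖ ^ 2 := by
  refine Summable.of_nonneg_of_le (fun _ => sq_nonneg _) (fun k => ?_) (summable_norm_mono hz)
  refine pow_le_of_le_one (norm_nonneg _) ?_ two_ne_zero
  rw [mono, norm_prod]
  refine Finset.prod_le_one (fun _ _ => norm_nonneg _) fun i _ => ?_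
  rw [norm_pow]
  exact pow_le_one₀ (norm_nonneg _) (apply_mem_ball hz i).le

/-- The Szegő kernel at `z` in the direction `a`. -/
def szego {z : Fin n → ℂ} (hz : z ∈ ball (0 : Fin n → ℂ) 1) (a : E) : H2 n E :=
  ⟨fun k => (starRingEnd ℂ) (mono z k) • a, by
    refine memℓp_two_iff.mpr ?_
    simpa only [norm_smul, mul_pow, RCLike.norm_conj] using
      (summable_norm_mono_sq hz).mul_right (‖a‖ ^ 2)⟩

theorem inner_szego {z : Fin n → ℂ} (hz : z ∈ ball (0 : Fin n → ℂ) 1) (a : E) (f : H2 n E) :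
    ⟪szego hz a, f⟫_ℂ = ⟪a, eval f z⟫_ℂ := by
  refine (lp.hasSum_inner (szego hz a) f).unique ?_
  rw [← innerSL_apply_apply ℂ]
  convert (hasSum_eval f hz).mapL (innerSL ℂ a) using 2 with k
  change ⟪(starRingEnd ℂ) (mono z k) • a, f k⟫_ℂ = ⟪a, mono z k • f k⟫_ℂ
  rw [inner_smul_left, inner_smul_right, RCLike.conj_conj]

/-- The value of the Szegő kernel on the diagonal. -/
def szegoDiag (z : Fin n → ℂ) : ℝ := ∑' k : Fin n → ℕ, ‖mono z k‖ ^ 2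

theorem szegoDiag_pos {z : Fin n → ℂ} (hz : z ∈ ball (0 : Fin n → ℂ) 1) : 0 < szegoDiag z :=
  (summable_norm_mono_sq hz).tsum_pos (fun _ => sq_nonneg _) 0 (by simp [mono])

theorem eval_szego {z : Fin n → ℂ} (hz : z ∈ ball (0 : Fin n → ℂ) 1) (a : E) :
    eval (szego hz a) z = (szegoDiag z : ℂ) • a := by
  refine (hasSum_eval (szego hz a) hz).unique ?_
  have h : HasSum (fun k : Fin n → ℕ => ((‖mono z k‖ ^ 2 : ℝ) : ℂ)) (szegoDiag z : ℂ) :=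
    Complex.hasSum_ofReal.mpr (summable_norm_mono_sq hz).hasSum
  convert h.smul_const a using 2 with k
  change mono z k • (starRingEnd ℂ) (mono z k) • a = _
  rw [smul_smul, RCLike.mul_conj]
  push_cast
  rfl

theorem norm_szego_sq {z : Fin n → ℂ} (hz : z ∈ ball (0 : Fin n → ℂ) 1) (a : E) :
    ‖szego hz a‖ ^ 2 = szegoDiag z * ‖a‖ ^ 2 := by
  have h := inner_szego hz a (szego hz a)
  rw [eval_szego, inner_smul_right, inner_self_eq_norm_sq_to_K, inner_self_eq_norm_sq_to_K] at h
  have h' : (‖szego hz a‖ : ℂ) ^ 2 = (szegoDiag z : ℂ) * (‖a‖ : ℂ) ^ 2 := h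
  exact_mod_cast h'

variable {V : H2 n F →ₗᵢ[ℂ] H2 n E} (hV : ∀ k f, V (shift n F k f) = shift n E k (V f))
include hV

/-- On monomials, `V (z^k a) = z^k V a`, so the action of `V` on constants determines it pointwise.
-/
theorem eval_apply_of_commute_shift {z : Fin n → ℂ} (hz : z ∈ ball (0 : Fin n → ℂ) 1)
    (L : F →L[ℂ] E) (hL : ∀ η, L η = eval (V (const n η)) z) (f : H2 n F) :
    eval (V f) z = L (eval f z) := by
  have : evalCLM hz ∘L V.toContinuousLinearMap = L ∘L evalCLM hz := by
    refine clm_eq_of_single fun k a => ?_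
    simp only [ContinuousLinearMap.comp_apply, LinearIsometry.coe_toContinuousLinearMap,
      evalCLM_apply]
    rw [eval_single, ← shift_const, hV, eval_shift _ _ hz, map_smul, hL]
  exact congr($this f)

/-- Pair the kernel in direction `L η` with `V` of the kernel in direction `η`. With `c = szegoDiag
z`, the reproducing property gives `c ‖L η‖²`, while Cauchy–Schwarz and isometry of `V` bound this
by `c ‖L η‖ ‖η‖`. -/
theorem norm_eval_const_le_of_commute_shift {z : Fin n → ℂ} (hz : z ∈ ball (0 : Fin n → ℂ) 1)
    (L : F →L[ℂ] E) (hL : ∀ η, L η = eval (V (const n η)) z) : ‖L‖ ≤ 1 := by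
  refine opNorm_le_bound _ zero_le_one fun η => ?_
  have hc := szegoDiag_pos hz
  have h1 : ⟪szego hz (L η), V (szego hz η)⟫_ℂ = (szegoDiag z : ℂ) * (‖L η‖ : ℂ) ^ 2 := by
    rw [inner_szego, eval_apply_of_commute_shift hV hz L hL, eval_szego, map_smul,
      inner_smul_right, inner_self_eq_norm_sq_to_K]
    rfl
  have h2 : szegoDiag z * ‖L η‖ ^ 2 ≤ ‖szego hz (L η)‖ * ‖szego hz η‖ := by
    have := norm_inner_le_norm (𝕜 := ℂ) (szego hz (L η)) (V (szego hz η))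
    rwa [h1, LinearIsometry.norm_map, norm_mul, norm_pow, Complex.norm_real, Complex.norm_real,
      norm_norm, Real.norm_of_nonneg hc.le] at this
  -- Squaring avoids square roots, since the kernel norms are known through their squares.
  have h3 : (szegoDiag z * ‖L η‖ ^ 2) ^ 2 ≤
      (szegoDiag z * ‖L η‖ ^ 2) * (szegoDiag z * ‖η‖ ^ 2) := by
    rw [← norm_szego_sq hz, ← norm_szego_sq hz, ← mul_pow]
    rw [← norm_szego_sq hz] at h2
    exact pow_le_pow_left₀ (by positivity) h2 2
  rw [one_mul]
  rcases (norm_nonneg (L η)).eq_or_lt with h | h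
  · rw [← h]; exact norm_nonneg _
  · have h4 : 0 < szegoDiag z * ‖L η‖ ^ 2 := by positivity
    rw [sq (szegoDiag z * _)] at h3
    have h5 := le_of_mul_le_mul_left (le_of_mul_le_mul_left h3 h4) hc
    exact le_of_sq_le_sq h5 (norm_nonneg _)

/-- An isometry intertwining the shifts is an analytic multiplication operator. -/
theorem exists_mulOp_eq : ∃ Ψ : HInf n F E, Ψ.mulOp = V.toContinuousLinearMap := by
  obtain ⟨A, hA, hAe⟩ := exists_analytic_evalCLM (n := n) (E := E)
  let B : F →L[ℂ] H2 n E :=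
    V.toContinuousLinearMap ∘L (singleIsometry n F 0).toContinuousLinearMap
  have hB : ∀ z ∈ ball (0 : Fin n → ℂ) 1, ∀ η, (A z ∘L B) η = eval (V (const n η)) z :=
    fun z hz η => hAe z hz _
  let Ψ : HInf n F E :=
    { toFun := fun z => A z ∘L B
      analyticOnNhd' := fun z hz =>
        (((compL ℂ F (H2 n E) E).flip B).analyticAt _).comp (hA z hz)
      bounded' := ⟨1, fun z hz => norm_eval_const_le_of_commute_shift hV hz _ (hB z hz)⟩ }
  refine ⟨Ψ, ContinuousLinearMap.ext fun f => eq_of_eval_eq fun z hz => ?_⟩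
  rw [Ψ.eval_mulOp f hz]
  exact (eval_apply_of_commute_shift hV hz _ (hB z hz) f).symm

end Eval

/-! ### Inner symbols correspond to isometric multiplication operators -/

section Inner

variable {n : ℕ} {E : Type*} [NormedAddCommGroup E] [InnerProductSpace ℂ E] [CompleteSpace E]
  {F : Type*} [NormedAddCommGroup F] [InnerProductSpace ℂ F] [CompleteSpace F]

theorem HInf.mulOp_shift (Ψ : HInf n F E) (k : Fin n → ℕ) (f : H2 n F) :
    Ψ.mulOp (shift n F k f) = shift n E k (Ψ.mulOp f) :=
  eq_of_eval_eq fun z hz => by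
    rw [Ψ.eval_mulOp _ hz, eval_shift _ _ hz, eval_shift _ _ hz, Ψ.eval_mulOp _ hz, map_smul]

theorem inner_shift_shift (k l : Fin n → ℕ) (f g : H2 n E) :
    ⟪shift n E k f, shift n E l g⟫_ℂ =
      ∫ t, (starRingEnd ℂ) (character k t) * character l t *
        ⟪boundary n E f t, boundary n E g t⟫_ℂ ∂torusMeasure n := by
  rw [← (boundary n E).inner_map_map, MeasureTheory.L2.inner_def]
  refine integral_congr_ae ?_
  filter_upwards [boundary_shift k f, boundary_shift l g] with t h1 h2
  rw [h1, h2, inner_smul_left, inner_smul_right, mul_assoc]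

theorem const_add (η ξ : F) : const n (η + ξ) = const n η + const n ξ :=
  (singleIsometry n F 0).map_add η ξ

theorem const_smul (c : ℂ) (η : F) : const n (c • η) = c • const n η :=
  (singleIsometry n F 0).map_smul c η

/-- Polarization. The null set in the definition of inner depends on the vector, but only the four
vectors `η + c ξ` with `c ∈ {1, -1, i, -i}` are involved. -/
theorem HInf.IsInner.inner_boundary {Ψ : HInf n F E} (hΨ : Ψ.IsInner) (η ξ : F) :
    ∀ᵐ t ∂torusMeasure n, ⟪boundary n E (Ψ.mulOp (const n η)) t,
      boundary n E (Ψ.mulOp (const n ξ)) t⟫_ℂ = ⟪η, ξ⟫_ℂ := by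
  have key : ∀ c : ℂ, ∀ᵐ t ∂torusMeasure n, ‖boundary n E (Ψ.mulOp (const n η)) t +
      c • boundary n E (Ψ.mulOp (const n ξ)) t‖ = ‖η + c • ξ‖ := by
    intro c
    have h := hΨ (η + c • ξ)
    rw [const_add, const_smul, map_add, map_smul, map_add, map_smul] at h
    filter_upwards [h, Lp.coeFn_add (boundary n E (Ψ.mulOp (const n η)))
      (c • boundary n E (Ψ.mulOp (const n ξ))),
      Lp.coeFn_smul c (boundary n E (Ψ.mulOp (const n ξ)))] with t h1 h2 h3
    rw [← h1, h2, Pi.add_apply, h3, Pi.smul_apply]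
  filter_upwards [key 1, key (-1), key Complex.I, key (-Complex.I)] with t h1 h2 h3 h4
  simp only [one_smul, neg_smul, ← sub_eq_add_neg] at h1 h2 h3 h4
  rw [inner_eq_sum_norm_sq_div_four, inner_eq_sum_norm_sq_div_four]
  simp only [RCLike.I_to_complex, h1, h2, h3, h4]

theorem inner_single_single_eq_integral (k l : Fin n → ℕ) (η ξ : F) :
    ⟪(lp.single 2 k η : H2 n F), lp.single 2 l ξ⟫_ℂ =
      ∫ t, (starRingEnd ℂ) (character k t) * character l t * ⟪η, ξ⟫_ℂ ∂torusMeasure n := by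
  rw [inner_single_single, integral_mul_const, inner_character]
  split_ifs <;> simp

/-- Inner functions induce isometric multiplication operators. -/
theorem HInf.IsInner.norm_mulOp {Ψ : HInf n F E} (hΨ : Ψ.IsInner) (f : H2 n F) :
    ‖Ψ.mulOp f‖ = ‖f‖ := by
  refine (norm_map_iff_adjoint_comp_self Ψ.mulOp).mpr ?_ f
  refine clm_eq_of_single fun l ξ => ?_
  refine ext_inner_left ℂ fun g => ?_
  -- Testing against monomials suffices, and there both inner products are integrals of `conj (ζ^k)
  -- ζ^l` times a boundary inner product.
  have h : innerSL ℂ (adjoint Ψ.mulOp (Ψ.mulOp (lp.single 2 l ξ))) =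
      innerSL ℂ (lp.single 2 l ξ : H2 n F) := by
    refine clm_eq_of_single fun k η => ?_
    rw [innerSL_apply_apply, innerSL_apply_apply, adjoint_inner_left, ← shift_const k,
      ← shift_const l, Ψ.mulOp_shift, Ψ.mulOp_shift, inner_shift_shift, shift_const, shift_const,
      inner_single_single_eq_integral]
    refine integral_congr_ae ?_
    filter_upwards [hΨ.inner_boundary ξ η] with t ht
    rw [ht]
  have h2 := congr($h g)
  rw [innerSL_apply_apply, innerSL_apply_apply] at h2
  rw [← inner_conj_symm, ContinuousLinearMap.comp_apply, h2, inner_conj_symm]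
  rfl

/-- Uniqueness of Fourier coefficients in `L¹`. Trigonometric polynomials are uniformly dense in the
continuous functions, so the finite measures with densities `u` and `v` agree on continuous
functions, hence coincide; nonnegativity makes these densities genuine measures. -/
theorem ae_eq_of_integral_mFourier {u v : UnitAddTorus (Fin n) → ℝ} (hu0 : 0 ≤ u) (hv0 : 0 ≤ v)
    (hu : Integrable u (torusMeasure n)) (hv : Integrable v (torusMeasure n))
    (h : ∀ m : Fin n → ℤ, ∫ t, UnitAddTorus.mFourier m t * (u t : ℂ) ∂torusMeasure n =
      ∫ t, UnitAddTorus.mFourier m t * (v t : ℂ) ∂torusMeasure n) :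
    u =ᵐ[torusMeasure n] v := by
  have main : ∀ φ : C(UnitAddTorus (Fin n), ℂ), ∫ t, φ t * (u t : ℂ) ∂torusMeasure n =
      ∫ t, φ t * (v t : ℂ) ∂torusMeasure n := by
    have hint : ∀ w : UnitAddTorus (Fin n) → ℝ, Integrable w (torusMeasure n) →
        ∃ L : C(UnitAddTorus (Fin n), ℂ) →L[ℂ] ℂ,
          ∀ φ, L φ = ∫ t, φ t * (w t : ℂ) ∂torusMeasure n := by
      intro w hw
      have hφ : ∀ φ : C(UnitAddTorus (Fin n), ℂ),
          Integrable (fun t => φ t * (w t : ℂ)) (torusMeasure n) := fun φ =>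
        hw.ofReal.bdd_mul (c := ‖φ‖) φ.continuous.aestronglyMeasurable
          (ae_of_all _ fun t => φ.norm_coe_le_norm t)
      refine ⟨LinearMap.mkContinuous
        { toFun := fun φ => ∫ t, φ t * (w t : ℂ) ∂torusMeasure n
          map_add' := fun φ ψ => by
            rw [← integral_add (hφ φ) (hφ ψ)]
            simp only [ContinuousMap.add_apply, add_mul]
          map_smul' := fun c φ => by
            rw [RingHom.id_apply, ← integral_smul]
            simp only [ContinuousMap.smul_apply, smul_eq_mul, mul_assoc] }
        (∫ t, ‖(w t : ℂ)‖ ∂torusMeasure n) fun φ => ?_, fun φ => rfl⟩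
      change ‖∫ t, φ t * (w t : ℂ) ∂torusMeasure n‖ ≤ _
      rw [mul_comm, ← integral_const_mul]
      refine norm_integral_le_of_norm_le (hw.ofReal.norm.const_mul _) (ae_of_all _ fun t => ?_)
      rw [norm_mul]
      exact mul_le_mul_of_nonneg_right (φ.norm_coe_le_norm t) (norm_nonneg _)
    obtain ⟨Lu, hLu⟩ := hint u hu
    obtain ⟨Lv, hLv⟩ := hint v hv
    have hL : Lu = Lv := by
      refine ContinuousLinearMap.ext_on
        (Submodule.dense_iff_topologicalClosure_eq_top.mpr
          UnitAddTorus.span_mFourier_closure_eq_top) ?_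
      rintro _ ⟨m, rfl⟩
      rw [hLu, hLv, h]
    intro φ
    rw [← hLu, ← hLv, hL]
  have hmeas : (torusMeasure n).withDensity (fun t => ENNReal.ofReal (u t)) =
      (torusMeasure n).withDensity (fun t => ENNReal.ofReal (v t)) := by
    have := isFiniteMeasure_withDensity_ofReal hu.2
    have := isFiniteMeasure_withDensity_ofReal hv.2
    refine ext_of_forall_integral_eq_of_IsFiniteMeasure fun φ => ?_
    have hreal : ∀ w : UnitAddTorus (Fin n) → ℝ, 0 ≤ w → Integrable w (torusMeasure n) →
        ((∫ t, φ t ∂(torusMeasure n).withDensity (fun t => ENNReal.ofReal (w t)) : ℝ) : ℂ) =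
          ∫ t, (⟨fun t => (φ t : ℂ), by fun_prop⟩ : C(UnitAddTorus (Fin n), ℂ)) t * (w t : ℂ)
            ∂torusMeasure n := by
      intro w hw0 hw
      rw [integral_withDensity_eq_integral_toReal_smul₀ hw.1.aemeasurable.ennreal_ofReal
        (ae_of_all _ fun _ => ENNReal.ofReal_lt_top), ← integral_complex_ofReal]
      refine integral_congr_ae (ae_of_all _ fun t => ?_)
      simp only [ContinuousMap.coe_mk, smul_eq_mul, ENNReal.toReal_ofReal (hw0 t)]
      push_cast
      ring
    have h3 := main ⟨fun t => (φ t : ℂ), by fun_prop⟩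
    rw [← hreal u hu0 hu, ← hreal v hv0 hv] at h3
    exact_mod_cast h3
  have hae := (withDensity_eq_iff hu.1.aemeasurable.ennreal_ofReal
    hv.1.aemeasurable.ennreal_ofReal hu.lintegral_lt_top.ne).mp hmeas
  filter_upwards [hae] with t ht
  rwa [ENNReal.ofReal_eq_ofReal_iff (hu0 t) (hv0 t)] at ht

/-- An integer exponent is the difference of its positive and negative parts, so inner products of
shifts with natural exponents see every Fourier coefficient. -/
theorem exists_character_eq_mFourier (m : Fin n → ℤ) :
    ∃ k l : Fin n → ℕ, ∀ t, (starRingEnd ℂ) (character k t) * character l t =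
      UnitAddTorus.mFourier m t := by
  refine ⟨fun i => (-m i).toNat, fun i => (m i).toNat, fun t => ?_⟩
  rw [character, character, ← UnitAddTorus.mFourier_neg, ← UnitAddTorus.mFourier_add]
  congr 2
  ext i
  simp only [Pi.add_apply, Pi.neg_apply]
  omega

/-- Isometric multiplication operators have inner symbols. -/
theorem HInf.isInner_of_norm_mulOp {Ψ : HInf n F E} (h : ∀ f, ‖Ψ.mulOp f‖ = ‖f‖) :
    Ψ.IsInner := by
  intro η
  set g := Ψ.mulOp (const n η)
  let V : H2 n F →ₗᵢ[ℂ] H2 n E := ⟨Ψ.mulOp.toLinearMap, h⟩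
  have hu : Integrable (fun t => ‖boundary n E g t‖ ^ 2) (torusMeasure n) :=
    (Lp.memLp (boundary n E g)).integrable_norm_pow two_ne_zero
  -- The Fourier coefficients of `‖Ψ η‖²` are the inner products `⟪z^k Ψ η, z^l Ψ η⟫ = ⟪z^k η, z^l
  -- η⟫`, which are those of the constant `‖η‖²`.
  have hae := ae_eq_of_integral_mFourier (v := fun _ => ‖η‖ ^ 2) (fun t => sq_nonneg _)
    (fun t => sq_nonneg _) hu (integrable_const _) fun m => by
      obtain ⟨k, l, hkl⟩ := exists_character_eq_mFourier m
      have h1 : ⟪shift n E k g, shift n E l g⟫_ℂ =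
          ⟪(lp.single 2 k η : H2 n F), lp.single 2 l η⟫_ℂ := by
        rw [← Ψ.mulOp_shift, ← Ψ.mulOp_shift, shift_const, shift_const]
        exact V.inner_map_map _ _
      rw [inner_shift_shift, inner_single_single_eq_integral] at h1
      simpa only [hkl, inner_self_eq_norm_sq_to_K, Complex.ofReal_pow] using! h1
  filter_upwards [hae] with t ht
  exact (sq_eq_sq₀ (norm_nonneg _) (norm_nonneg _)).mp ht

theorem exists_isInner_mulOp_eq {V : H2 n F →ₗᵢ[ℂ] H2 n E}
    (hV : ∀ k f, V (shift n F k f) = shift n E k (V f)) :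
    ∃ Ψ : HInf n F E, Ψ.IsInner ∧ ∀ f, Ψ.mulOp f = V f := by
  obtain ⟨Ψ, hΨ⟩ := exists_mulOp_eq hV
  refine ⟨Ψ, HInf.isInner_of_norm_mulOp fun f => ?_, fun f => by rw [hΨ]; rfl⟩
  rw [hΨ]
  exact V.norm_map f

end Inner

/-! ### Partial isometries and hyponormality -/

section PartialIsometry

variable {H : Type*} [NormedAddCommGroup H] [InnerProductSpace ℂ H] [CompleteSpace H]
  {T : H →L[ℂ] H}

/-- The initial space of an operator. -/
def initialSpace (T : H →L[ℂ] H) : Submodule ℂ H := (LinearMap.ker (T : H →ₗ[ℂ] H))ᗮ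

instance : CompleteSpace (initialSpace T) :=
  (Submodule.isClosed_orthogonal _).completeSpace_coe

theorem mem_orthogonal_initialSpace {x : H} : x ∈ (initialSpace T)ᗮ ↔ T x = 0 := by
  have : CompleteSpace (LinearMap.ker (T : H →ₗ[ℂ] H)) := T.isClosed_ker.completeSpace_coe
  rw [initialSpace, Submodule.orthogonal_orthogonal]
  exact LinearMap.mem_ker

theorem apply_starProjection (x : H) : T ((initialSpace T).starProjection x) = T x := by
  have h := mem_orthogonal_initialSpace.mp
    ((initialSpace T).sub_starProjection_mem_orthogonal x)
  rw [map_sub, sub_eq_zero] at h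
  exact h.symm

theorem IsPartialIsometry.norm_apply (hT : IsPartialIsometry T) (x : H) :
    ‖T x‖ = ‖(initialSpace T).starProjection x‖ := by
  rw [← apply_starProjection]
  exact hT _ ((initialSpace T).starProjection_apply_mem x)

theorem IsPartialIsometry.norm_apply_le (hT : IsPartialIsometry T) (x : H) : ‖T x‖ ≤ ‖x‖ := by
  rw [hT.norm_apply]
  exact (initialSpace T).norm_starProjection_apply_le x

theorem IsPartialIsometry.mem_of_norm_eq (hT : IsPartialIsometry T) {x : H} (h : ‖T x‖ = ‖x‖) :
    x ∈ initialSpace T := by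
  rw [Submodule.mem_iff_norm_starProjection, ← hT.norm_apply, h]

/-- A partial isometry as an isometry on its initial space. -/
def IsPartialIsometry.toIsometry (hT : IsPartialIsometry T) : initialSpace T →ₗᵢ[ℂ] H where
  toLinearMap := (T : H →ₗ[ℂ] H) ∘ₗ (initialSpace T).subtype
  norm_map' x := hT x x.2

theorem IsPartialIsometry.inner_map_map (hT : IsPartialIsometry T) {x y : H}
    (hx : x ∈ initialSpace T) (hy : y ∈ initialSpace T) : ⟪T x, T y⟫_ℂ = ⟪x, y⟫_ℂ :=
  hT.toIsometry.inner_map_map ⟨x, hx⟩ ⟨y, hy⟩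

/-- The quadratic form of `T^* T - T T^*` at `x` is `‖T x‖² - ‖T^* x‖²`. -/
theorem isHyponormal_iff_norm_adjoint_le :
    IsHyponormal T ↔ ∀ x, ‖adjoint T x‖ ≤ ‖T x‖ := by
  have key : ∀ x, RCLike.re ⟪(adjoint T ∘L T - T ∘L adjoint T) x, x⟫_ℂ =
      ‖T x‖ ^ 2 - ‖adjoint T x‖ ^ 2 := by
    intro x
    have h : ⟪T (adjoint T x), x⟫_ℂ = ⟪adjoint T x, adjoint T x⟫_ℂ :=
      (adjoint_inner_right T _ _).symm
    rw [sub_apply, inner_sub_left, ContinuousLinearMap.comp_apply, ContinuousLinearMap.comp_apply,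
      adjoint_inner_left, h, map_sub, inner_self_eq_norm_sq, inner_self_eq_norm_sq]
  rw [IsHyponormal, ContinuousLinearMap.le_def, isPositive_def']
  constructor
  · intro h x
    have := h.2 x
    rw [reApplyInnerSelf_apply, key] at this
    exact le_of_sq_le_sq (by linarith) (norm_nonneg _)
  · intro h
    refine ⟨?_, fun x => ?_⟩
    · rw [IsSelfAdjoint, star_sub, star_eq_adjoint, star_eq_adjoint, adjoint_comp, adjoint_comp,
        adjoint_adjoint]
    · rw [reApplyInnerSelf_apply, key, sub_nonneg]
      exact pow_le_pow_left₀ (norm_nonneg _) (h x) 2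

/-- The norm inequality gives `ker T ⊆ ker T^*`, and `ran T` is orthogonal to `ker T^*`. -/
theorem IsHyponormal.apply_mem_initialSpace (hT : IsHyponormal T) (x : H) :
    T x ∈ initialSpace T := by
  intro y hy
  have hy' : T y = 0 := hy
  have h := isHyponormal_iff_norm_adjoint_le.mp hT y
  rw [hy', norm_zero, norm_le_zero_iff] at h
  rw [← adjoint_inner_left, h, inner_zero_left]

end PartialIsometry

/-! ### Shifts on the initial space, and their double commutation -/

section Toeplitz

variable {n : ℕ} {E : Type*} [NormedAddCommGroup E] [InnerProductSpace ℂ E] [CompleteSpace E]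
  {T : H2 n E →L[ℂ] H2 n E} (hT : IsPartialIsometry T)
  (hS : ∀ k f, backshift n E k (T (shift n E k f)) = T f)
include hT hS

/-- Squeezed between contractivity of `T` and of `M_k^*`, as `M_k^* (T M_k f) = T f` already has
norm `‖f‖`. -/
theorem norm_toeplitz_shift {f : H2 n E} (hf : f ∈ initialSpace T) (k : Fin n → ℕ) :
    ‖T (shift n E k f)‖ = ‖f‖ := by
  refine le_antisymm ((hT.norm_apply_le _).trans (LinearIsometry.norm_map _ _).le) ?_
  rw [← hT f hf, ← hS k f]
  exact norm_backshift_le _ _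

theorem shift_mem_initialSpace {f : H2 n E} (hf : f ∈ initialSpace T) (k : Fin n → ℕ) :
    shift n E k f ∈ initialSpace T :=
  hT.mem_of_norm_eq <| by rw [norm_toeplitz_shift hT hS hf, LinearIsometry.norm_map]

/-- Both vectors have norm `‖f‖`, and by Brown–Halmos their inner product is `‖T f‖² = ‖f‖²`; this
is the equality case of Cauchy–Schwarz. -/
theorem toeplitz_shift {f : H2 n E} (hf : f ∈ initialSpace T) (k : Fin n → ℕ) :
    T (shift n E k f) = shift n E k (T f) := by
  have h1 : ‖T (shift n E k f) - shift n E k (T f)‖ ^ 2 = 0 := by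
    rw [@norm_sub_sq ℂ, ← inner_backshift_left, hS, norm_toeplitz_shift hT hS hf,
      LinearIsometry.norm_map, hT f hf, inner_self_eq_norm_sq, hT f hf]
    ring
  exact sub_eq_zero.mp (norm_eq_zero.mp (pow_eq_zero_iff two_ne_zero |>.mp h1))

/-- The shift on the initial space of `T`. -/
def initialShift (k : Fin n → ℕ) : initialSpace T →ₗᵢ[ℂ] initialSpace T where
  toLinearMap := (shift n E k).toLinearMap.restrict fun _ hf => shift_mem_initialSpace hT hS hf k
  norm_map' f := (shift n E k).norm_map f

theorem coe_initialShift (k : Fin n → ℕ) (f : initialSpace T) :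
    (initialShift hT hS k f : H2 n E) = shift n E k f := rfl

/-- The adjoint of the shift on the initial space of `T`. -/
def initialCoshift (k : Fin n → ℕ) : initialSpace T →L[ℂ] initialSpace T :=
  adjoint (initialShift hT hS k).toContinuousLinearMap

theorem inner_initialCoshift_left (k : Fin n → ℕ) (f g : initialSpace T) :
    ⟪initialCoshift hT hS k f, g⟫_ℂ = ⟪(f : H2 n E), shift n E k g⟫_ℂ :=
  adjoint_inner_left _ _ _

theorem initialCoshift_initialShift (k : Fin n → ℕ) (f : initialSpace T) :
    initialCoshift hT hS k (initialShift hT hS k f) = f :=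
  ext_inner_right ℂ fun g => by
    rw [inner_initialCoshift_left, coe_initialShift, LinearIsometry.inner_map_map]
    rfl

theorem initialCoshift_eq_zero_iff {k : Fin n → ℕ} {f : initialSpace T} :
    initialCoshift hT hS k f = 0 ↔
      ∀ g ∈ initialSpace T, ⟪(f : H2 n E), shift n E k g⟫_ℂ = 0 := by
  constructor
  · intro h g hg
    have := inner_initialCoshift_left hT hS k f ⟨g, hg⟩
    rwa [h, inner_zero_left, eq_comm] at this
  · intro h
    exact ext_inner_right ℂ fun g => by
      rw [inner_initialCoshift_left, h g g.2, inner_zero_left]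

/-- First source of good vectors: `M_i^*` commutes with `M_k` on `H²`, so `M_k f` is orthogonal to
all of `M_i H²`, in particular to `M_i N`. -/
theorem initialCoshift_shift_of_backshift_eq_zero {i : Fin n} {k : Fin n → ℕ} (hk : k i = 0)
    {f : initialSpace T} (hf : backshift n E (Pi.single i 1) (f : H2 n E) = 0) :
    initialCoshift hT hS (Pi.single i 1) (initialShift hT hS k f) = 0 := by
  refine (initialCoshift_eq_zero_iff hT hS).mpr fun g _ => ?_
  rw [coe_initialShift, ← inner_backshift_left, backshift_shift_comm hk, hf, map_zero,
    inner_zero_left]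

/-- Second source: `T` preserves inner products on `N` and intertwines the shifts there, so the
argument above can be run on the image `T f`. -/
theorem initialCoshift_shift_of_apply_backshift_eq_zero {i : Fin n} {k : Fin n → ℕ} (hk : k i = 0)
    {f : initialSpace T} (hf : backshift n E (Pi.single i 1) (T f) = 0) :
    initialCoshift hT hS (Pi.single i 1) (initialShift hT hS k f) = 0 := by
  refine (initialCoshift_eq_zero_iff hT hS).mpr fun g hg => ?_
  rw [coe_initialShift, ← hT.inner_map_map (shift_mem_initialSpace hT hS f.2 k)
    (shift_mem_initialSpace hT hS hg _), toeplitz_shift hT hS f.2, toeplitz_shift hT hS hg,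
    ← inner_backshift_left, backshift_shift_comm hk, hf, map_zero, inner_zero_left]

/-- The wandering subspace of a coordinate shift on the initial space is invariant under the
shifts in the other variables: it is spanned by vectors annihilated by the backshift and by vectors
whose image under `T` is annihilated by the backshift. -/
theorem initialCoshift_shift_eq_zero {i : Fin n} {k : Fin n → ℕ} (hk : k i = 0)
    {w : initialSpace T} (hw : initialCoshift hT hS (Pi.single i 1) w = 0) :
    initialCoshift hT hS (Pi.single i 1) (initialShift hT hS k w) = 0 := by
  set e : Fin n → ℕ := Pi.single i 1
  let A : initialSpace T →L[ℂ] initialSpace T :=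
    initialCoshift hT hS e ∘L (initialShift hT hS k).toContinuousLinearMap
  -- `Y` collects the wandering vectors of `R_i` for which the claim holds. The part `b` of `w`
  -- orthogonal to `Y` turns out to lie in `Y`, hence vanishes.
  let Y : Submodule ℂ (initialSpace T) := LinearMap.ker (initialCoshift hT hS e :
    initialSpace T →ₗ[ℂ] initialSpace T) ⊓ LinearMap.ker (A : initialSpace T →ₗ[ℂ] initialSpace T)
  have hY : ∀ f, f ∈ Y ↔ initialCoshift hT hS e f = 0 ∧
    initialCoshift hT hS e (initialShift hT hS k f) = 0 := fun f => Iff.rfl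
  have hYc : IsClosed (Y : Set (initialSpace T)) :=
    (initialCoshift hT hS e).isClosed_ker.inter A.isClosed_ker
  have : CompleteSpace Y := hYc.completeSpace_coe
  set b := w - Y.starProjection w
  have hbo : b ∈ Yᗮ := Y.sub_starProjection_mem_orthogonal w
  have hbw : initialCoshift hT hS e b = 0 := by
    rw [map_sub, hw, ((hY _).mp (Y.starProjection_apply_mem w)).1, sub_zero]
  -- For `h ∈ ker T` the projection `v` of `M_i h` to `N` is in `Y`: it is orthogonal to `M_i N`,
  -- and `M_i^* T v = M_i^* T M_i h = T h = 0`. Hence `b ⊥ v`.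
  have hdefect : ∀ h : H2 n E, T h = 0 → ⟪shift n E e h, (b : H2 n E)⟫_ℂ = 0 := by
    intro h hh
    let v : initialSpace T := ⟨(initialSpace T).starProjection (shift n E e h),
      (initialSpace T).starProjection_apply_mem _⟩
    have hv : ∀ g ∈ initialSpace T, ⟪(v : H2 n E), g⟫_ℂ = ⟪shift n E e h, g⟫_ℂ := by
      intro g hg
      have := (initialSpace T).starProjection_inner_eq_zero (shift n E e h) g hg
      rw [inner_sub_left, sub_eq_zero] at this
      exact this.symm
    rw [← hv b b.2]
    refine hbo v ((hY v).mpr ⟨?_, ?_⟩)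
    · refine (initialCoshift_eq_zero_iff hT hS).mpr fun g hg => ?_
      rw [hv _ (shift_mem_initialSpace hT hS hg e), LinearIsometry.inner_map_map]
      exact inner_eq_zero_symm.mp (mem_orthogonal_initialSpace.mpr hh g hg)
    · refine initialCoshift_shift_of_apply_backshift_eq_zero hT hS hk ?_
      change backshift n E e (T ((initialSpace T).starProjection (shift n E e h))) = 0
      rw [apply_starProjection, hS, hh]
  -- `M_i^* b` is orthogonal to `ker T` by `hdefect`, and to `N` because `b` is wandering for `R_i`.
  have hb0 : backshift n E e (b : H2 n E) = 0 := by
    refine ext_inner_left ℂ fun f => ?_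
    rw [inner_backshift_right, inner_zero_right,
      ← add_sub_cancel ((initialSpace T).starProjection f) f, map_add, inner_add_left,
      hdefect (f - (initialSpace T).starProjection f)
        (by rw [map_sub, apply_starProjection, sub_self]), add_zero]
    exact inner_eq_zero_symm.mp ((initialCoshift_eq_zero_iff hT hS).mp hbw _
      ((initialSpace T).starProjection_apply_mem f))
  have hbY : b ∈ Y :=
    (hY b).mpr ⟨hbw, initialCoshift_shift_of_backshift_eq_zero hT hS hk hb0⟩
  have hbz : b = 0 := inner_self_eq_zero.mp (hbo b hbY)
  have hwY : w ∈ Y := by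
    rw [sub_eq_zero.mp hbz]
    exact Y.starProjection_apply_mem w
  exact ((hY w).mp hwY).2

/-- The shifts on the initial space of a partially isometric Toeplitz operator are doubly
commuting. -/
def initialShifts : DoublyCommutingShifts n (initialSpace T) where
  op := initialShift hT hS
  op_zero f := Subtype.ext (shift_zero _)
  op_add k l f := Subtype.ext (shift_add k l _)
  adjoint_op_comm i k hk f := by
    change initialCoshift hT hS _ _ = initialShift hT hS k (initialCoshift hT hS _ f)
    set e : Fin n → ℕ := Pi.single i 1
    have hcomm : ∀ g, initialShift hT hS k (initialShift hT hS e g) =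
        initialShift hT hS e (initialShift hT hS k g) := fun g => Subtype.ext <| by
      simp only [coe_initialShift]
      rw [← shift_add, ← shift_add, add_comm]
    -- Apply the invariance to the wandering part `f - R_i R_i^* f`. On the rest, `R_i^* R_k R_i
    -- R_i^* f = R_k R_i^* f`.
    have h := initialCoshift_shift_eq_zero hT hS hk
      (w := f - initialShift hT hS e (initialCoshift hT hS e f))
      (by rw [map_sub, initialCoshift_initialShift, sub_self])
    rw [map_sub, map_sub, hcomm, initialCoshift_initialShift, sub_eq_zero] at h
    exact h
  pure i f h := Subtype.ext <| eq_zero_of_mem_range_shift i fun m => by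
    obtain ⟨g, hg⟩ := h m
    exact ⟨g, by rw [← hg]; rfl⟩

end Toeplitz

/-! ### Beurling form of the initial space, and the factorization -/

section Factorization

variable {n : ℕ}

/-- The initial space of a partially isometric Toeplitz operator is of the form `Ψ H²_F(𝔻ⁿ)`. -/
theorem exists_isometry_range_eq_initialSpace {E : Type u} [NormedAddCommGroup E]
    [InnerProductSpace ℂ E] [CompleteSpace E] {T : H2 n E →L[ℂ] H2 n E} (hT : IsPartialIsometry T)
    (hS : ∀ k f, backshift n E k (T (shift n E k f)) = T f) :
    ∃ (F : Type u) (_ : NormedAddCommGroup F) (_ : InnerProductSpace ℂ F) (_ : CompleteSpace F)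
      (V : H2 n F →ₗᵢ[ℂ] H2 n E), (∀ k f, V (shift n F k f) = shift n E k (V f)) ∧
        ∀ f, f ∈ initialSpace T ↔ ∃ g, V g = f := by
  let R := initialShifts hT hS
  refine ⟨R.wandering, inferInstance, inferInstance, inferInstance,
    (initialSpace T).subtypeₗᵢ.comp R.model, fun k f => ?_, fun f => ⟨fun hf => ?_, ?_⟩⟩
  · exact congrArg Subtype.val (R.model_shift k f)
  · obtain ⟨g, hg⟩ := R.model_surjective ⟨f, hf⟩
    exact ⟨g, congrArg Subtype.val hg⟩
  · rintro ⟨g, rfl⟩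
    exact (R.model g).2

variable {E F : Type*} [NormedAddCommGroup E] [InnerProductSpace ℂ E] [CompleteSpace E]
  [NormedAddCommGroup F] [InnerProductSpace ℂ F] [CompleteSpace F]

theorem norm_adjoint_apply_le_of_norm_map {A : H2 n F →L[ℂ] H2 n E} (hA : ∀ f, ‖A f‖ = ‖f‖)
    (f : H2 n E) : ‖adjoint A f‖ ≤ ‖f‖ := by
  refine ((adjoint A).le_of_opNorm_le ?_ f).trans (one_mul _).le
  rw [LinearIsometryEquiv.norm_map]
  exact opNorm_le_bound _ zero_le_one fun g => by rw [hA, one_mul]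

theorem isHyponormal_of_factorization {A : H2 n F →L[ℂ] H2 n E} {B : H2 n F →L[ℂ] H2 n F}
    (hA : ∀ f, ‖A f‖ = ‖f‖) (hB : ∀ f, ‖B f‖ = ‖f‖) : IsHyponormal (A ∘L B ∘L adjoint A) := by
  refine isHyponormal_iff_norm_adjoint_le.mpr fun f => ?_
  rw [adjoint_comp, adjoint_comp, adjoint_adjoint]
  simp only [ContinuousLinearMap.comp_apply, hA, hB]
  exact norm_adjoint_apply_le_of_norm_map hB _

end Factorization

end
end PolydiscHardy

theorem theorem4p5 {n : ℕ} {E : Type u} [NormedAddCommGroup E] [InnerProductSpace ℂ E]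
    [CompleteSpace E] (Φ : PolydiscHardy.LInf n E)
    (hΦ : PolydiscHardy.IsPartialIsometry Φ.toeplitz) :
    PolydiscHardy.IsHyponormal Φ.toeplitz ↔
      ∃ (F : Type u) (_ : NormedAddCommGroup F) (_ : InnerProductSpace ℂ F) (_ : CompleteSpace F)
        (Ψ : PolydiscHardy.HInf n F E) (Θ : PolydiscHardy.HInf n F F),
        Ψ.IsInner ∧ Θ.IsInner ∧
          Φ.toeplitz = Ψ.mulOp ∘L Θ.mulOp ∘L ContinuousLinearMap.adjoint Ψ.mulOp := by
  open PolydiscHardy ContinuousLinearMap in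
  constructor
  · intro hyp
    have hS := backshift_toeplitz_shift Φ
    obtain ⟨F, _, _, _, V, hV, hr⟩ := exists_isometry_range_eq_initialSpace hΦ hS
    have hmem : ∀ g, V g ∈ initialSpace Φ.toeplitz := fun g => (hr _).mpr ⟨g, rfl⟩
    -- The one use of hyponormality: `T V g` lies in the range of `V`, so `W = V⁻¹ T V` makes sense.
    choose W hW using fun g => (hr _).mp (hyp.apply_mem_initialSpace (V g))
    let W' : H2 n F →ₗᵢ[ℂ] H2 n F :=
      { toFun := W
        map_add' := fun f g => V.injective <| by simp only [hW, map_add]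
        map_smul' := fun c f => V.injective <| by simp only [hW, map_smul, RingHom.id_apply]
        norm_map' := fun f => (V.norm_map (W f)).symm.trans <| by
          rw [hW, hΦ _ (hmem f), V.norm_map] }
    have hW' : ∀ k f, W' (shift n F k f) = shift n F k (W' f) := fun k f => V.injective <| by
      change V (W _) = V (shift n F k (W f))
      rw [hW, hV, hV, hW, toeplitz_shift hΦ hS (hmem f)]
    obtain ⟨Ψ, hΨ, hΨV⟩ := exists_isInner_mulOp_eq hV
    obtain ⟨Θ, hΘ, hΘW⟩ := exists_isInner_mulOp_eq hW'
    refine ⟨F, _, _, _, Ψ, Θ, hΨ, hΘ, ContinuousLinearMap.ext fun f => ?_⟩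
    obtain ⟨g, hg⟩ := (hr _).mp ((initialSpace Φ.toeplitz).starProjection_apply_mem f)
    -- `V V^*` is the projection onto the range of `V`, so `V^* f` is the preimage of the projection
    -- of `f`.
    have hadj : adjoint Ψ.mulOp f = g := by
      refine ext_inner_right ℂ fun h => ?_
      have h0 := (initialSpace Φ.toeplitz).starProjection_inner_eq_zero f (V h) (hmem h)
      rw [inner_sub_left, sub_eq_zero, ← hg, V.inner_map_map] at h0
      rw [adjoint_inner_left, hΨV, h0]
    rw [ContinuousLinearMap.comp_apply, ContinuousLinearMap.comp_apply, hadj, hΘW, hΨV,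
      ← apply_starProjection, ← hg]
    exact (hW g).symm
  · rintro ⟨F, _, _, _, Ψ, Θ, hΨ, hΘ, h⟩
    rw [h]
    exact isHyponormal_of_factorization hΨ.norm_mulOp hΘ.norm_mulOp
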